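/- **Setting.** Let $\rho$ be a probability measure on a measurable space $\mathcal Z$, let $\Omega\subseteq\mathbb R^d$ be closed and convex (for instance $\Omega=\mathbb R^d$), and let $f:\mathbb R^d\times\mathcal Z\to\mathbb R$ be a measurable loss such that, for every $z$, the function $w\mapsto f(w;z)$ is nonnegative and convex on $\mathbb R^d$. Assume that $F(w)=\mathbb E_{z\sim\rho}[f(w;z)]$ is finite for every $w$, and let $w^*\in\Omega$ minimize $F$ over $\Omega$. Let $\partial f(w;z)$ be a measurable selection of subgradients of $w\mapsto f(w;z)$ that is $(\alpha,L)$-Hölder continuous, where $\alpha\in[0,1)$ and $L>0$: $$\|\partial f(w;z)-\partial f(\tilde w;z)\|_2\le L\|w-\tilde w\|_2^{\alpha}\qquad\text{for all } w,\tilde w\in\mathbb R^d,\ z\in\mathcal Z$$ (for $\alpha=0$ the right-hand side is $L$). Let $S=(z_1,\dots,z_n)$, $n\ge1$, be drawn i.i.d. from $\rho$ and, independently, let $i_1,i_2,\dots$ be i.i.d. uniform on $\{1,\dots,n\}$. Projected SGD with $T$ steps and constant step sizes $\eta_t=cT^{-\theta}$, where $c>0$ and $\theta\in[0,1]$, is $$w_1=0,\qquad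 w_{t+1}=\Pi_\Omega\big(w_t-\eta_t\,\partial f(w_t;z_{i_t})\big),$$ with $\Pi_\Omega$ the Euclidean projection onto $\Omega$. Its averaged iterate is $w_T^{(1)}=\big(\sum_{t=1}^T\eta_tw_t\big)/\sum_{t=1}^T\eta_t$. Write $\mathbb E_{S,A}$ for the expectation over $S$ and the indices, and $T\asymp B$ for $\kappa_1B\le T\le\kappa_2B$ with fixed constants $\kappa_1,\kappa_2>0$. **Theorem (generalization bounds, Hölder case).** The expected risk $\mathbb E_{S,A}[F(w_T^{(1)})]$ is finite, and the following hold. (a) If $\alpha\ge\frac12$, $\theta=\frac12$ and $T\asymp n$, then $\mathbb E_{S,A}[F(w_T^{(1)})]-F(w^*)=O(n^{-1/2})$. (b) If $\alpha<\frac12$, $\theta=\frac{3-3\alpha}{2(2-\alpha)}$ and $T\asymp n^{\frac{2-\alpha}{1+\alpha}}$, then $\mathbb E_{S,A}[F(w_T^{(1)})]-F(w^*)=O(n^{-1/2})$. (For $\alpha=0$, the case that covers for example the hinge loss on bounded data, this reads $\theta=\frac34$ and $T\asymp n^2$.) (c) If $F(w^*)=0$, $\theta=\frac{3-\alpha^2-2\alpha}{4}$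 and $T\asymp n^{\frac{2}{1+\alpha}}$, then $\mathbb E_{S,A}[F(w_T^{(1)})]-F(w^*)=O(n^{-\frac{1+\alpha}{2}})$. Here $O(r_n)$ means that the absolute value is at most $C\,r_n$ for all $n\ge1$ and all such $T$, where $C$ depends only on $\alpha$, $L$, $c$, $\kappa_1$, $\kappa_2$ and on upper bounds for $\|w^*\|_2$ and $F(w^*)$. -/

import Mathlib

open MeasureTheory

noncomputable section

/-- `g` is a subgradient selection of the loss `f` in its first argument: for each model `w` and
example `z`, the vector `g w z` is a subgradient of `f · z` at `w`. -/
def IsSubgradientSelection {d : ℕ} {Z : Type*}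
    (f : EuclideanSpace ℝ (Fin d) → Z → ℝ)
    (g : EuclideanSpace ℝ (Fin d) → Z → EuclideanSpace ℝ (Fin d)) : Prop :=
  ∀ (z : Z) (w v : EuclideanSpace ℝ (Fin d)), f w z + inner ℝ (g w z) (v - w) ≤ f v z

/-- `(α, L)`-Hölder continuity of `w ↦ g w z`, uniformly in `z`. For `α = 0` the right-hand side
is the constant `L`. -/
def IsHolderSubgradient {d : ℕ} {Z : Type*} (α L : ℝ)
    (g : EuclideanSpace ℝ (Fin d) → Z → EuclideanSpace ℝ (Fin d)) : Prop :=
  ∀ (w v : EuclideanSpace ℝ (Fin d)) (z : Z), ‖g w z - g v z‖ ≤ L * ‖w - v‖ ^ α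

/-- The population risk `F(w) = 𝔼_z[f(w; z)]`. -/
def populationRisk {d : ℕ} {Z : Type*} [MeasurableSpace Z] (ρ : Measure Z)
    (f : EuclideanSpace ℝ (Fin d) → Z → ℝ) (w : EuclideanSpace ℝ (Fin d)) : ℝ :=
  ∫ z, f w z ∂ρ

/-- A nonempty closed set contains a nearest point to every `w`. -/
theorem exists_nearest {d : ℕ} {Ω : Set (EuclideanSpace ℝ (Fin d))} (hc : IsClosed Ω)
    (hn : Ω.Nonempty) (w : EuclideanSpace ℝ (Fin d)) :
    ∃ p ∈ Ω, ∀ q ∈ Ω, ‖w - p‖ ≤ ‖w - q‖ := by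
  obtain ⟨p, hp, h⟩ := hc.exists_infDist_eq_dist hn w
  refine ⟨p, hp, fun q hq => ?_⟩
  rw [← dist_eq_norm, ← dist_eq_norm, ← h]
  exact Metric.infDist_le_dist_of_mem hq

open Classical in
/-- The projection onto `Ω`: the point of `Ω` nearest to `w`. For nonempty closed convex `Ω` this
point exists and is unique; when there is no nearest point the value is `w`. -/
def projOn {d : ℕ} (Ω : Set (EuclideanSpace ℝ (Fin d))) (w : EuclideanSpace ℝ (Fin d)) :
    EuclideanSpace ℝ (Fin d) :=
  if h : ∃ p ∈ Ω, ∀ q ∈ Ω, ‖w - p‖ ≤ ‖w - q‖ then h.choose else w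

theorem projOn_spec {d : ℕ} {Ω : Set (EuclideanSpace ℝ (Fin d))} (hc : IsClosed Ω)
    (hn : Ω.Nonempty) (w : EuclideanSpace ℝ (Fin d)) :
    projOn Ω w ∈ Ω ∧ ∀ q ∈ Ω, ‖w - projOn Ω w‖ ≤ ‖w - q‖ := by
  have h := exists_nearest hc hn w
  rw [projOn, dif_pos h]
  exact h.choose_spec

/-- The iterates of projected SGD on the sample `S` with step sizes `η 1, η 2, …` and the drawn
indices `i`. Here `sgdIterate Ω g η S i k` is the iterate `w_{k+1}`, so `w_1 = 0`,
`w_{t+1} = Π_Ω (w_t - η_t • g(w_t; z_{i_t}))` for `1 ≤ t ≤ T`, and `i_t` is `i ⟨t - 1, _⟩`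
(the sequence is frozen after `w_{T+1}`; those entries are never used). -/
def sgdIterate {d n T : ℕ} {Z : Type*} (Ω : Set (EuclideanSpace ℝ (Fin d)))
    (g : EuclideanSpace ℝ (Fin d) → Z → EuclideanSpace ℝ (Fin d)) (η : ℕ → ℝ)
    (S : Fin n → Z) (i : Fin T → Fin n) : ℕ → EuclideanSpace ℝ (Fin d)
  | 0 => 0
  | k + 1 =>
    if h : k < T then
      projOn Ω (sgdIterate Ω g η S i k - η (k + 1) • g (sgdIterate Ω g η S i k) (S (i ⟨k, h⟩)))
    else sgdIterate Ω g η S i k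

/-- The averaged iterate `(∑_{t=1}^T η_t w_t) / ∑_{t=1}^T η_t`. -/
def sgdAverage {d n T : ℕ} {Z : Type*} (Ω : Set (EuclideanSpace ℝ (Fin d)))
    (g : EuclideanSpace ℝ (Fin d) → Z → EuclideanSpace ℝ (Fin d)) (η : ℕ → ℝ)
    (S : Fin n → Z) (i : Fin T → Fin n) : EuclideanSpace ℝ (Fin d) :=
  (∑ k ∈ Finset.range T, η (k + 1))⁻¹ •
    ∑ k ∈ Finset.range T, η (k + 1) • sgdIterate Ω g η S i k

/-- `𝔼_{S,A}[F(averaged iterate of T steps)]`: the sample `S` consists of `n` independent draws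
from `ρ`, and the indices `i_1, …, i_T` are independent of `S` and of each other and uniform on
`n` values, i.e. the index sequence is uniform on the `n ^ T` maps `Fin T → Fin n`. -/
def expectedRisk {d : ℕ} {Z : Type*} [MeasurableSpace Z] (ρ : Measure Z)
    (Ω : Set (EuclideanSpace ℝ (Fin d))) (f : EuclideanSpace ℝ (Fin d) → Z → ℝ)
    (g : EuclideanSpace ℝ (Fin d) → Z → EuclideanSpace ℝ (Fin d)) (η : ℕ → ℝ) (n T : ℕ) : ℝ :=
  ((n : ℝ) ^ T)⁻¹ * ∑ i : Fin T → Fin n,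
    ∫ S : Fin n → Z, populationRisk ρ f (sgdAverage Ω g η S i) ∂(Measure.pi fun _ => ρ)

/-- The constant step size `η_t = c T^{-θ}`. -/
def constStep (c θ : ℝ) (T : ℕ) : ℕ → ℝ := fun _ => c * (T : ℝ) ^ (-θ)

end

/-! The excess risk splits into an optimization error and a generalization gap, both controlled by
the mean training loss `X` along the trajectory. Gradients are tied to losses by self-bounding: a
nonnegative convex loss with Hölder subgradients satisfies `‖g w z‖² ≤ q (l + f w z)` for every
level `l > 0`, with `q` of order `l ^ (-(1-α)/(1+α))`. Being linear in the loss, this survives every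
expectation.

Optimization (`optimization_bound`): expanding the squared distance to the minimizer `w*` and
telescoping gives `X - F(w*) ≲ 1/(hT) + h q (l + X)`.

Generalization (`generalization_bound`, `stability_bound`): exchange `z_j` with an independent copy.
The perturbed run does not see `z_j`, so its loss there has mean equal to the expected risk;
convexity and Young's inequality bound that mean by `X`, a multiple of the risk that can be
absorbed, and the mean squared distance between the two averages. A step on a common example is
nonexpansive up to `4 (hL)^(2/(1-α))`; the replaced example is drawn with probability `1/n` and then
expands by at most `1 + n/T`, up to gradient terms. The growth `1 + 1/T` per step costs only a
factor `e` over `T` steps, and the distance is of order `T h^(2/(1-α)) + q (1 + T/n) (h² T/n) (l +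
X)`.

For (a) and (b) the level `l` is a constant and the Young weight is of order `√n`. For (c) the level
is proportional to the target rate, which is the expected size of the risk. Since `w_1 = 0` may lie
outside `Ω`, the excess risk may be negative; a separate lower bound of order `1/T` controls its
absolute value. -/

/-! ### Convex functions with Hölder continuous subgradients -/

section HolderSubgradient

variable {E : Type*} [NormedAddCommGroup E] [InnerProductSpace ℝ E]

/-- If `φ` minus a linear functional is bounded below by `m`, then the gap to `m` controls the
distance from the subgradient to that functional. -/
theorem holder_subgradient_gap {φ : E → ℝ} {G : E → E} {α L : ℝ}
    (hL : 0 ≤ L)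
    (hG : ∀ w v, φ w + inner ℝ (G w) (v - w) ≤ φ v)
    (hH : ∀ w v, ‖G w - G v‖ ≤ L * ‖w - v‖ ^ α)
    {b : E} {m : ℝ} (hb : ∀ v, m ≤ φ v - inner ℝ b v) (w : E) {s : ℝ} (hs : 0 ≤ s) :
    s * (‖G w - b‖ - L * s ^ α) ≤ φ w - inner ℝ b w - m := by
  by_cases ha : ‖G w - b‖ = 0
  · have h1 := hb w
    have h2 : 0 ≤ s * (L * s ^ α) := by positivity
    rw [ha]
    nlinarith
  have hapos : 0 < ‖G w - b‖ := lt_of_le_of_ne (norm_nonneg _) (Ne.symm ha)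
  set u : E := ‖G w - b‖⁻¹ • (G w - b) with hu
  have hun : ‖u‖ = 1 := by
    rw [hu, norm_smul, norm_inv, norm_norm, inv_mul_cancel₀ ha]
  have hGu : inner ℝ (G w - b) u = ‖G w - b‖ := by
    rw [hu, inner_smul_right, real_inner_self_eq_norm_sq]
    field_simp
  -- Convexity is tested at a point displaced by `s` along `G w - b`; the Hölder bound then carries
  -- the subgradient from `v` back to `w`, with no integration along the segment.
  set v : E := w - s • u with hv
  have hwv : w - v = s • u := by rw [hv]; abel
  have h1 := hG v w
  have h2 := hb v
  have h3 : ‖G w - G v‖ ≤ L * s ^ α := by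
    have := hH w v
    rwa [hwv, norm_smul, hun, mul_one, Real.norm_of_nonneg hs] at this
  have h4 : inner ℝ (G w - G v) u ≤ L * s ^ α := by
    have := real_inner_le_norm (G w - G v) u
    rw [hun, mul_one] at this
    exact this.trans h3
  have h5 : inner ℝ b w - inner ℝ b v = s * inner ℝ b u := by
    rw [← inner_sub_right, hwv, inner_smul_right]
  rw [hwv, inner_smul_right] at h1
  rw [inner_sub_left] at h4 hGu
  nlinarith

/-- Self-bounding property of Hölder subgradients of nonnegative convex functions, in a form that
is linear in the function value. -/
theorem holder_subgradient_self_bounding {φ : E → ℝ} {G : E → E} {α L : ℝ}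
    (hα₀ : 0 ≤ α) (hα₁ : α < 1) (hL : 0 ≤ L)
    (hG : ∀ w v, φ w + inner ℝ (G w) (v - w) ≤ φ v)
    (hH : ∀ w v, ‖G w - G v‖ ≤ L * ‖w - v‖ ^ α)
    (h0 : ∀ w, 0 ≤ φ w) {l : ℝ} (hl : 0 < l) (w : E) :
    ‖G w‖ ^ 2 ≤ (1 + L) ^ 2 * l ^ (-((1 - α) / (1 + α))) * (l + φ w) := by
  have hα' : 0 < 1 + α := by linarith
  -- Truncating the value below at `l` keeps the base of the negative power away from zero.
  set m := max (φ w) l with hm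
  have hmpos : 0 < m := lt_of_lt_of_le hl (le_max_right _ _)
  -- This displacement balances the two terms of the gap: `s * s ^ α = m`.
  set s := m ^ (1 / (1 + α)) with hs
  have hspos : 0 < s := Real.rpow_pos_of_pos hmpos _
  have h1 := holder_subgradient_gap (b := 0) (m := 0) hL hG hH (by simpa using h0) w hspos.le
  simp only [sub_zero, inner_zero_left] at h1
  have hsα : s * s ^ α = m := by
    rw [← Real.rpow_one_add' hspos.le (by positivity), hs, ← Real.rpow_mul hmpos.le,
      one_div_mul_cancel hα'.ne', Real.rpow_one]
  have h2 : s * ‖G w‖ ≤ (1 + L) * m := by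
    have : φ w ≤ m := le_max_left _ _
    nlinarith
  have h3 : s ^ 2 * ‖G w‖ ^ 2 ≤ (1 + L) ^ 2 * m ^ 2 := by
    rw [← mul_pow, ← mul_pow]
    exact pow_le_pow_left₀ (by positivity) h2 2
  have hs2 : s ^ 2 * m ^ (-((1 - α) / (1 + α))) * m = m ^ 2 := by
    rw [hs, ← Real.rpow_natCast, ← Real.rpow_mul hmpos.le, ← Real.rpow_add hmpos,
      ← Real.rpow_add_one hmpos.ne', ← Real.rpow_natCast]
    congr 1
    push_cast
    field_simp
    ring
  have h4 : ‖G w‖ ^ 2 ≤ (1 + L) ^ 2 * m ^ (-((1 - α) / (1 + α))) * m := by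
    have : s ^ 2 * ‖G w‖ ^ 2 ≤ s ^ 2 * ((1 + L) ^ 2 * m ^ (-((1 - α) / (1 + α))) * m) := by
      calc s ^ 2 * ‖G w‖ ^ 2 ≤ (1 + L) ^ 2 * m ^ 2 := h3
        _ = _ := by rw [← hs2]; ring
    exact le_of_mul_le_mul_left this (by positivity)
  refine h4.trans ?_
  have h5 : m ^ (-((1 - α) / (1 + α))) ≤ l ^ (-((1 - α) / (1 + α))) :=
    Real.rpow_le_rpow_of_nonpos hl (le_max_right _ _)
      (neg_nonpos.2 (div_nonneg (by linarith) hα'.le))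
  have h6 : m ≤ l + φ w := max_le (by linarith) (by linarith [h0 w])
  gcongr

/-- A gradient step with a Hölder subgradient is nonexpansive up to an additive error. -/
theorem holder_subgradient_step {φ : E → ℝ} {G : E → E} {α L : ℝ}
    (hα₀ : 0 ≤ α) (hα₁ : α < 1) (hL : 0 ≤ L)
    (hG : ∀ w v, φ w + inner ℝ (G w) (v - w) ≤ φ v)
    (hH : ∀ w v, ‖G w - G v‖ ≤ L * ‖w - v‖ ^ α) {h : ℝ} (hh : 0 ≤ h) (w v : E) :
    ‖(w - h • G w) - (v - h • G v)‖ ^ 2 ≤ ‖w - v‖ ^ 2 + 4 * (h * L) ^ (2 / (1 - α)) := by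
  have key : ∀ (w v : E) {s : ℝ}, 0 ≤ s →
      s * (‖G w - G v‖ - L * s ^ α) ≤ φ w - φ v - inner ℝ (G v) (w - v) := by
    intro w v s hs
    have := holder_subgradient_gap (b := G v) (m := φ v - inner ℝ (G v) v) hL hG hH
      (fun x => by have := hG v x; rw [inner_sub_right] at this; linarith) w hs
    rw [inner_sub_right]
    linarith
  set a := ‖G w - G v‖ with ha
  -- Since `h * a = 2 * s`, the sum of the two gap inequalities contributes `-8 s²` against the `4
  -- s²` of the squared displacement; the remaining `-4 s²` absorbs the Hölder error.
  set s := h * a / 2 with hs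
  have hs0 : 0 ≤ s := by positivity
  have h1 := key w v hs0
  have h2 := key v w hs0
  rw [norm_sub_rev (G v) (G w), ← ha] at h2
  have h3 : inner ℝ (G w) (v - w) = - inner ℝ (G w) (w - v) := by
    rw [← inner_neg_right]; congr 1; abel
  have hin : 2 * (s * (a - L * s ^ α)) ≤ inner ℝ (w - v) (G w - G v) := by
    rw [real_inner_comm, inner_sub_left]; linarith
  have hexp : ‖(w - h • G w) - (v - h • G v)‖ ^ 2
      = ‖w - v‖ ^ 2 - 2 * (h * inner ℝ (w - v) (G w - G v)) + (h * a) ^ 2 := by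
    have : (w - h • G w) - (v - h • G v) = (w - v) - h • (G w - G v) := by
      rw [smul_sub]; abel
    rw [this, norm_sub_sq_real, inner_smul_right, norm_smul, Real.norm_of_nonneg hh]
  have hha : h * a = 2 * s := by rw [hs]; ring
  -- A form of Young's inequality: according to whether `h * L` is below or above `s ^ (1 - α)`, one
  -- of the two terms on the right suffices.
  have hbound : h * L * (s * s ^ α) ≤ s ^ 2 + (h * L) ^ (2 / (1 - α)) := by
    have hp : 0 ≤ (h * L) ^ (2 / (1 - α)) := by positivity
    rcases hs0.eq_or_lt with h0 | hspos
    · rw [← h0]; simpa using hp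
    have hα' : 0 < 1 - α := by linarith
    have hss : s ^ (1 - α) * (s * s ^ α) = s ^ 2 := by
      rw [← Real.rpow_one_add' hspos.le (by positivity), ← Real.rpow_add hspos,
        ← Real.rpow_natCast]
      congr 1; push_cast; ring
    rcases le_total (h * L) (s ^ (1 - α)) with hc | hc
    · have : h * L * (s * s ^ α) ≤ s ^ (1 - α) * (s * s ^ α) := by gcongr
      linarith
    · have hhL : 0 < h * L := lt_of_lt_of_le (Real.rpow_pos_of_pos hspos _) hc
      have hsle : s ≤ (h * L) ^ (1 / (1 - α)) := by
        have := Real.rpow_le_rpow (by positivity) hc (z := 1 / (1 - α)) (by positivity)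
        rwa [← Real.rpow_mul hspos.le, mul_one_div_cancel hα'.ne', Real.rpow_one] at this
      have : h * L * (s * s ^ α) ≤ (h * L) ^ (2 / (1 - α)) := by
        rw [← Real.rpow_one_add' hspos.le (by positivity)]
        calc h * L * s ^ (1 + α) ≤ h * L * ((h * L) ^ (1 / (1 - α))) ^ (1 + α) := by gcongr
          _ = (h * L) ^ (2 / (1 - α)) := by
            rw [← Real.rpow_mul hhL.le, ← Real.rpow_one_add' hhL.le (by positivity)]
            congr 1; field_simp; ring
      nlinarith [sq_nonneg s]
  rw [hexp, hha]
  have h5 : h * (2 * (s * (a - L * s ^ α))) ≤ h * inner ℝ (w - v) (G w - G v) := by gcongr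
  have h6 : h * (2 * (s * (a - L * s ^ α))) = 2 * s * (h * a) - 2 * (h * L * (s * s ^ α)) := by
    ring
  rw [hha] at h6
  nlinarith

end HolderSubgradient

/-! ### Projection onto a closed convex set -/

section Projection

variable {d : ℕ} {Ω : Set (EuclideanSpace ℝ (Fin d))}

theorem projOn_inner_nonpos (hc : IsClosed Ω) (hconv : Convex ℝ Ω)
    {y : EuclideanSpace ℝ (Fin d)} (hy : y ∈ Ω) (x : EuclideanSpace ℝ (Fin d)) :
    inner ℝ (x - projOn Ω x) (y - projOn Ω x) ≤ 0 := by
  have hn : Ω.Nonempty := ⟨y, hy⟩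
  obtain ⟨h1, h2⟩ := projOn_spec hc hn x
  refine (norm_eq_iInf_iff_real_inner_le_zero hconv h1).1 ?_ y hy
  have : Nonempty Ω := hn.to_subtype
  refine le_antisymm (le_ciInf fun q => h2 q q.2) ?_
  exact ciInf_le (f := fun q : Ω => ‖x - q‖) ⟨0, by rintro _ ⟨q, rfl⟩; exact norm_nonneg _⟩
    ⟨_, h1⟩

theorem norm_projOn_sub_projOn_le (hc : IsClosed Ω) (hconv : Convex ℝ Ω) (hn : Ω.Nonempty)
    (x y : EuclideanSpace ℝ (Fin d)) : ‖projOn Ω x - projOn Ω y‖ ≤ ‖x - y‖ := by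
  have h1 := projOn_inner_nonpos hc hconv (projOn_spec hc hn y).1 x
  have h2 := projOn_inner_nonpos hc hconv (projOn_spec hc hn x).1 y
  set p := projOn Ω x
  set q := projOn Ω y
  have h3 : ‖p - q‖ ^ 2 ≤ inner ℝ (x - y) (p - q) := by
    rw [← real_inner_self_eq_norm_sq]
    have e : inner ℝ (x - y) (p - q) - inner ℝ (p - q) (p - q)
        = -inner ℝ (x - p) (q - p) - inner ℝ (y - q) (p - q) := by
      simp only [inner_sub_left, inner_sub_right]; ring
    linarith
  have h4 := real_inner_le_norm (x - y) (p - q)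
  nlinarith [norm_nonneg (p - q), norm_nonneg (x - y)]

theorem projOn_of_mem (hc : IsClosed Ω) {y : EuclideanSpace ℝ (Fin d)} (hy : y ∈ Ω) :
    projOn Ω y = y := by
  have := (projOn_spec hc ⟨y, hy⟩ y).2 y hy
  rw [sub_self, norm_zero, norm_le_zero_iff, sub_eq_zero] at this
  exact this.symm

theorem norm_projOn_sub_le (hc : IsClosed Ω) (hconv : Convex ℝ Ω)
    {y : EuclideanSpace ℝ (Fin d)} (hy : y ∈ Ω) (x : EuclideanSpace ℝ (Fin d)) :
    ‖projOn Ω x - y‖ ≤ ‖x - y‖ := by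
  simpa [projOn_of_mem hc hy] using norm_projOn_sub_projOn_le hc hconv ⟨y, hy⟩ x y

theorem continuous_projOn (hc : IsClosed Ω) (hconv : Convex ℝ Ω) (hn : Ω.Nonempty) :
    Continuous (projOn Ω) :=
  (LipschitzWith.of_dist_le_mul (K := 1) fun x y => by
    simpa [dist_eq_norm] using norm_projOn_sub_projOn_le hc hconv hn x y).continuous

end Projection

/-! ### Averages over index sequences and a discrete Grönwall inequality -/

section Averaging

/-- Averaging over an index sequence: the `k`-th index may be replaced by an independent one as
long as the summand does not otherwise depend on it. -/
theorem expect_apply_index {T n : ℕ} (k : Fin T) (ψ : (Fin T → Fin n) → Fin n → ℝ)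
    (hψ : ∀ i a, ψ (Function.update i k a) = ψ i) :
    Finset.expect Finset.univ (fun i : Fin T → Fin n => ψ i (i k))
      = Finset.expect Finset.univ fun i : Fin T → Fin n =>
          Finset.expect Finset.univ fun j => ψ i j := by
  rcases Nat.eq_zero_or_pos n with rfl | hn
  · exact Finset.expect_congr rfl fun i _ => (i k).elim0
  have : Nonempty (Fin n) := ⟨⟨0, hn⟩⟩
  have h1 : Finset.expect Finset.univ (fun i : Fin T → Fin n => ψ i (i k))
      = Finset.expect (Finset.univ ×ˢ Finset.univ)
        fun x : (Fin T → Fin n) × Fin n => ψ x.1 (x.1 k) := by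
    rw [Finset.expect_product]
    exact Finset.expect_congr rfl fun i _ => (Fintype.expect_const _).symm
  rw [h1, ← Finset.expect_product' Finset.univ Finset.univ ψ]
  -- Swapping the `k`-th index with the additional one is an involution, and `ψ` does not see the
  -- change in its first argument.
  refine Finset.expect_nbij' (fun x => (Function.update x.1 k x.2, x.1 k))
    (fun x => (Function.update x.1 k x.2, x.1 k)) (by simp) (by simp) (by simp) (by simp) ?_
  intro x _
  simp [hψ]

/-- Independence of the current draw from the past: the source of the factor `1 / n` in the
stability recursion. -/
theorem expect_ite_index {T n : ℕ} (k : Fin T) (j : Fin n) (φ : (Fin T → Fin n) → ℝ)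
    (hφ : ∀ i a, φ (Function.update i k a) = φ i) :
    Finset.expect Finset.univ (fun i : Fin T → Fin n => if i k = j then φ i else 0)
      = (n : ℝ)⁻¹ * Finset.expect Finset.univ φ := by
  rw [expect_apply_index k (fun i m => if m = j then φ i else 0) (fun i a => by simp [hφ]),
    Finset.mul_expect]
  refine Finset.expect_congr rfl fun i _ => ?_
  rw [Fintype.expect_eq_sum_div_card]
  simp
  ring

theorem norm_smul_sum_sq_le {E : Type*} [NormedAddCommGroup E] [NormedSpace ℝ E] (T : ℕ)
    (v : ℕ → E) :
    ‖(T : ℝ)⁻¹ • ∑ k ∈ Finset.range T, v k‖ ^ 2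
      ≤ (T : ℝ)⁻¹ * ∑ k ∈ Finset.range T, ‖v k‖ ^ 2 := by
  have h1 : ‖∑ k ∈ Finset.range T, v k‖ ^ 2 ≤ T * ∑ k ∈ Finset.range T, ‖v k‖ ^ 2 := by
    calc ‖∑ k ∈ Finset.range T, v k‖ ^ 2 ≤ (∑ k ∈ Finset.range T, ‖v k‖) ^ 2 := by
          gcongr; exact norm_sum_le _ _
      _ ≤ _ := by simpa using sq_sum_le_card_mul_sum_sq (s := Finset.range T) (f := fun k => ‖v k‖)
  rw [norm_smul, mul_pow, Real.norm_of_nonneg (by positivity)]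
  calc ((T : ℝ)⁻¹) ^ 2 * ‖∑ k ∈ Finset.range T, v k‖ ^ 2
      ≤ ((T : ℝ)⁻¹) ^ 2 * (T * ∑ k ∈ Finset.range T, ‖v k‖ ^ 2) := by gcongr
    _ = _ := by
      rcases Nat.eq_zero_or_pos T with rfl | hT
      · simp
      · field_simp

/-- Discrete Grönwall inequality over a horizon `T` with growth rate `1 / T`. -/
theorem gronwall_horizon {T : ℕ} {D b : ℕ → ℝ} (hD : D 0 = 0) (hb : ∀ s, 0 ≤ b s)
    (h : ∀ k < T, D (k + 1) ≤ (1 + (T : ℝ)⁻¹) * D k + b k) {k : ℕ} (hk : k ≤ T) :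
    D k ≤ Real.exp 1 * ∑ s ∈ Finset.range T, b s := by
  have hr : 1 ≤ 1 + (T : ℝ)⁻¹ := by
    have : 0 ≤ (T : ℝ)⁻¹ := by positivity
    linarith
  have key : ∀ k ≤ T, D k ≤ (1 + (T : ℝ)⁻¹) ^ k * ∑ s ∈ Finset.range k, b s := by
    intro k
    induction k with
    | zero => simp [hD]
    | succ k ih =>
      intro hk
      rw [Finset.sum_range_succ, mul_add, pow_succ']
      have h1 := ih (by omega)
      have h2 := h k (by omega)
      have h3 : b k ≤ (1 + (T : ℝ)⁻¹) * (1 + (T : ℝ)⁻¹) ^ k * b k := by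
        refine le_mul_of_one_le_left (hb k) ?_
        rw [← pow_succ']
        exact one_le_pow₀ hr
      have h4 : (1 + (T : ℝ)⁻¹) * D k
          ≤ (1 + (T : ℝ)⁻¹) * ((1 + (T : ℝ)⁻¹) ^ k * ∑ s ∈ Finset.range k, b s) := by gcongr
      linarith
  refine (key k hk).trans ?_
  have h1 : (1 + (T : ℝ)⁻¹) ^ k ≤ Real.exp 1 := by
    calc (1 + (T : ℝ)⁻¹) ^ k ≤ (1 + (T : ℝ)⁻¹) ^ T := pow_le_pow_right₀ hr hk
      _ ≤ (Real.exp (T : ℝ)⁻¹) ^ T := by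
        gcongr
        linarith [Real.add_one_le_exp (T : ℝ)⁻¹]
      _ = Real.exp (T * (T : ℝ)⁻¹) := (Real.exp_nat_mul _ _).symm
      _ ≤ Real.exp 1 := Real.exp_le_exp.2 mul_inv_le_one
  have h2 : ∑ s ∈ Finset.range k, b s ≤ ∑ s ∈ Finset.range T, b s :=
    Finset.sum_le_sum_of_subset_of_nonneg (Finset.range_mono hk) fun s _ _ => hb s
  exact mul_le_mul h1 h2 (Finset.sum_nonneg fun s _ => hb s) (Real.exp_nonneg _)

end Averaging

/-! ### Pathwise inequalities for projected SGD -/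

section Paths

variable {d n T : ℕ} {Z : Type*} {Ω : Set (EuclideanSpace ℝ (Fin d))}
  {f : EuclideanSpace ℝ (Fin d) → Z → ℝ}
  {g : EuclideanSpace ℝ (Fin d) → Z → EuclideanSpace ℝ (Fin d)} {α L h q l : ℝ}

theorem sgdIterate_succ (η : ℕ → ℝ) (S : Fin n → Z) (i : Fin T → Fin n) {k : ℕ} (hk : k < T) :
    sgdIterate Ω g η S i (k + 1) = projOn Ω (sgdIterate Ω g η S i k
      - η (k + 1) • g (sgdIterate Ω g η S i k) (S (i ⟨k, hk⟩))) := by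
  rw [sgdIterate, dif_pos hk]

/-- The iterate at position `k` reads only the indices `0, …, k - 1`, so the case `k = m` is
included. -/
theorem sgdIterate_update (η : ℕ → ℝ) (S : Fin n → Z) (i : Fin T → Fin n) (m : Fin T)
    (a : Fin n) {k : ℕ} (hk : k ≤ m) :
    sgdIterate Ω g η S (Function.update i m a) k = sgdIterate Ω g η S i k := by
  induction k with
  | zero => rfl
  | succ k ih =>
    have hkT : k < T := by omega
    have hne : (⟨k, hkT⟩ : Fin T) ≠ m := by
      intro h; rw [← h] at hk; simp at hk
    rw [sgdIterate_succ _ _ _ hkT, sgdIterate_succ _ _ _ hkT, ih (by omega),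
      Function.update_of_ne hne]

theorem sgdIterate_mem (hc : IsClosed Ω) (hn : Ω.Nonempty) (η : ℕ → ℝ) (S : Fin n → Z)
    (i : Fin T → Fin n) {k : ℕ} (hk : k < T) : sgdIterate Ω g η S i (k + 1) ∈ Ω := by
  rw [sgdIterate_succ _ _ _ hk]
  exact (projOn_spec hc hn _).1

theorem sgdAverage_const (hh : h ≠ 0) (S : Fin n → Z) (i : Fin T → Fin n) :
    sgdAverage Ω g (fun _ => h) S i
      = (T : ℝ)⁻¹ • ∑ k ∈ Finset.range T, sgdIterate Ω g (fun _ => h) S i k := by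
  rw [sgdAverage, ← Finset.smul_sum, smul_smul, Finset.sum_const, Finset.card_range,
    nsmul_eq_mul, mul_inv, mul_assoc, inv_mul_cancel₀ hh, mul_one]

/-- Jensen's inequality: in the sum of the subgradient inequalities at the average, the deviations
cancel. -/
theorem loss_sgdAverage_le (hsub : IsSubgradientSelection f g) (hT : 0 < T) (hh : h ≠ 0)
    (S : Fin n → Z) (i : Fin T → Fin n) (z : Z) :
    f (sgdAverage Ω g (fun _ => h) S i) z
      ≤ (T : ℝ)⁻¹ * ∑ k ∈ Finset.range T, f (sgdIterate Ω g (fun _ => h) S i k) z := by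
  set A := sgdAverage Ω g (fun _ => h) S i with hA
  have hT' : (T : ℝ) ≠ 0 := by positivity
  have h1 := Finset.sum_le_sum fun k (_ : k ∈ Finset.range T) =>
    hsub z A (sgdIterate Ω g (fun _ => h) S i k)
  have h2 : ∑ k ∈ Finset.range T, sgdIterate Ω g (fun _ => h) S i k = (T : ℝ) • A := by
    rw [hA, sgdAverage_const hh, smul_smul, mul_inv_cancel₀ hT', one_smul]
  have h3 : ∑ k ∈ Finset.range T, (sgdIterate Ω g (fun _ => h) S i k - A) = 0 := by
    rw [Finset.sum_sub_distrib, h2, Finset.sum_const, Finset.card_range,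
      ← Nat.cast_smul_eq_nsmul ℝ, sub_self]
  rw [Finset.sum_add_distrib, ← inner_sum, h3, inner_zero_right, add_zero, Finset.sum_const,
    Finset.card_range, nsmul_eq_mul] at h1
  rw [inv_mul_eq_div, le_div_iff₀ (by positivity)]
  linarith

theorem norm_sgdAverage_sub_sq_le (hh : h ≠ 0) (S S' : Fin n → Z) (i : Fin T → Fin n) :
    ‖sgdAverage Ω g (fun _ => h) S' i - sgdAverage Ω g (fun _ => h) S i‖ ^ 2
      ≤ (T : ℝ)⁻¹ * ∑ k ∈ Finset.range T,
        ‖sgdIterate Ω g (fun _ => h) S i k - sgdIterate Ω g (fun _ => h) S' i k‖ ^ 2 := by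
  rw [norm_sub_rev, sgdAverage_const hh, sgdAverage_const hh, ← smul_sub,
    ← Finset.sum_sub_distrib]
  exact norm_smul_sum_sq_le T _

/-- One-step progress inequality of projected SGD. -/
theorem sgdIterate_progress (hc : IsClosed Ω) (hconv : Convex ℝ Ω)
    (hsub : IsSubgradientSelection f g) (hh : 0 ≤ h) {v : EuclideanSpace ℝ (Fin d)} (hv : v ∈ Ω)
    (S : Fin n → Z) (i : Fin T → Fin n) {k : ℕ} (hk : k < T) :
    2 * h * (f (sgdIterate Ω g (fun _ => h) S i k) (S (i ⟨k, hk⟩)) - f v (S (i ⟨k, hk⟩)))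
      ≤ ‖sgdIterate Ω g (fun _ => h) S i k - v‖ ^ 2
        - ‖sgdIterate Ω g (fun _ => h) S i (k + 1) - v‖ ^ 2
        + h ^ 2 * ‖g (sgdIterate Ω g (fun _ => h) S i k) (S (i ⟨k, hk⟩))‖ ^ 2 := by
  rw [sgdIterate_succ _ _ _ hk]
  set w := sgdIterate Ω g (fun _ => h) S i k
  set z := S (i ⟨k, hk⟩)
  have h1 := norm_projOn_sub_le hc hconv hv (w - h • g w z)
  have h2 : ‖projOn Ω (w - h • g w z) - v‖ ^ 2 ≤ ‖w - h • g w z - v‖ ^ 2 := by gcongr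
  have h3 : ‖w - h • g w z - v‖ ^ 2
      = ‖w - v‖ ^ 2 - 2 * (h * inner ℝ (g w z) (w - v)) + h ^ 2 * ‖g w z‖ ^ 2 := by
    rw [sub_right_comm, norm_sub_sq_real, inner_smul_right, norm_smul, Real.norm_of_nonneg hh,
      mul_pow, real_inner_comm]
  have h4 := hsub z w v
  have h5 : inner ℝ (g w z) (v - w) = - inner ℝ (g w z) (w - v) := by
    rw [← inner_neg_right, neg_sub]
  have h6 : h * (f w z - f v z) ≤ h * inner ℝ (g w z) (w - v) := by
    gcongr; linarith
  linarith

/-- One-step stability recursion for two runs whose samples agree off the position `j`. -/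
theorem sgdIterate_stability (hc : IsClosed Ω) (hconv : Convex ℝ Ω) (hn : Ω.Nonempty)
    (hα₀ : 0 ≤ α) (hα₁ : α < 1) (hL : 0 ≤ L)
    (hsub : IsSubgradientSelection f g) (hhol : IsHolderSubgradient α L g) (hh : 0 ≤ h)
    {p : ℝ} (hp : 0 < p) {S S' : Fin n → Z} {j : Fin n} (hS : ∀ m, m ≠ j → S' m = S m)
    (i : Fin T → Fin n) {k : ℕ} (hk : k < T) :
    ‖sgdIterate Ω g (fun _ => h) S i (k + 1) - sgdIterate Ω g (fun _ => h) S' i (k + 1)‖ ^ 2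
      ≤ ‖sgdIterate Ω g (fun _ => h) S i k - sgdIterate Ω g (fun _ => h) S' i k‖ ^ 2
        + 4 * (h * L) ^ (2 / (1 - α))
        + if i ⟨k, hk⟩ = j then
            p * ‖sgdIterate Ω g (fun _ => h) S i k - sgdIterate Ω g (fun _ => h) S' i k‖ ^ 2
            + (1 + p⁻¹) * (2 * h ^ 2) * (‖g (sgdIterate Ω g (fun _ => h) S i k) (S j)‖ ^ 2
              + ‖g (sgdIterate Ω g (fun _ => h) S' i k) (S' j)‖ ^ 2)
          else 0 := by
  rw [sgdIterate_succ _ _ _ hk, sgdIterate_succ _ _ _ hk]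
  set w := sgdIterate Ω g (fun _ => h) S i k
  set w' := sgdIterate Ω g (fun _ => h) S' i k
  have h1 : ∀ x y : EuclideanSpace ℝ (Fin d),
      ‖projOn Ω x - projOn Ω y‖ ^ 2 ≤ ‖x - y‖ ^ 2 := fun x y => by
    gcongr; exact norm_projOn_sub_projOn_le hc hconv hn x y
  refine (h1 _ _).trans ?_
  split_ifs with hij
  · rw [hij]
    set a := g w (S j)
    set b := g w' (S' j)
    have hA : 0 ≤ 4 * (h * L) ^ (2 / (1 - α)) := by positivity
    have e : w - h • a - (w' - h • b) = (w - w') + h • (b - a) := by rw [smul_sub]; abel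
    -- The two gradients belong to unrelated examples, so nonexpansiveness is replaced by the
    -- triangle inequality, followed by Young's inequality with weight `p`.
    have h2 : ‖w - h • a - (w' - h • b)‖ ≤ ‖w - w'‖ + h * (‖a‖ + ‖b‖) := by
      rw [e]
      refine (norm_add_le _ _).trans ?_
      rw [norm_smul, Real.norm_of_nonneg hh]
      gcongr
      linarith [norm_sub_le b a]
    set x := ‖w - w'‖
    set y := h * (‖a‖ + ‖b‖) with hy
    have h3 : ‖w - h • a - (w' - h • b)‖ ^ 2 ≤ (x + y) ^ 2 := by gcongr
    have h4 : 2 * (x * y) ≤ p * x ^ 2 + p⁻¹ * y ^ 2 := by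
      have : 0 ≤ p⁻¹ * (p * x - y) ^ 2 := by positivity
      have e2 : p⁻¹ * (p * x - y) ^ 2 = p * x ^ 2 - 2 * (x * y) + p⁻¹ * y ^ 2 := by
        field_simp; ring
      linarith
    have h5 : (1 + p⁻¹) * y ^ 2 ≤ (1 + p⁻¹) * (2 * h ^ 2) * (‖a‖ ^ 2 + ‖b‖ ^ 2) := by
      rw [mul_assoc]
      gcongr
      rw [hy, mul_pow]
      nlinarith [mul_nonneg (sq_nonneg h) (sq_nonneg (‖a‖ - ‖b‖))]
    nlinarith
  · rw [hS _ hij, add_zero]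
    exact holder_subgradient_step (φ := fun w => f w (S (i ⟨k, hk⟩)))
      (G := fun w => g w (S (i ⟨k, hk⟩))) hα₀ hα₁ hL (fun w v => hsub _ w v)
      (fun w v => hhol w v _) hh w w'

/-- On-average stability of the iterates of SGD, averaged over the drawn indices and over the
replaced position. -/
theorem sgdIterate_average_stability (hc : IsClosed Ω) (hconv : Convex ℝ Ω) (hn : Ω.Nonempty)
    (hα₀ : 0 ≤ α) (hα₁ : α < 1) (hL : 0 ≤ L) (hf : ∀ w z, 0 ≤ f w z)
    (hsub : IsSubgradientSelection f g) (hhol : IsHolderSubgradient α L g) (hh : 0 ≤ h)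
    (hl : 0 ≤ l) (hq : 0 ≤ q) (hg : ∀ w z, ‖g w z‖ ^ 2 ≤ q * (l + f w z)) (hn0 : 0 < n)
    {S : Fin n → Z} {S' : Fin n → Fin n → Z} (hS : ∀ j m, m ≠ j → S' j m = S m)
    {k : ℕ} (hk : k ≤ T) :
    Finset.expect Finset.univ (fun i : Fin T → Fin n => Finset.expect Finset.univ fun j =>
        ‖sgdIterate Ω g (fun _ => h) S i k - sgdIterate Ω g (fun _ => h) (S' j) i k‖ ^ 2)
      ≤ Real.exp 1 * ∑ s ∈ Finset.range T, (4 * (h * L) ^ (2 / (1 - α))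
        + (1 + T / n) * (2 * h ^ 2 * q) / n * (2 * l +
          Finset.expect Finset.univ (fun i : Fin T → Fin n => Finset.expect Finset.univ fun j =>
            f (sgdIterate Ω g (fun _ => h) S i s) (S j)
              + f (sgdIterate Ω g (fun _ => h) (S' j) i s) (S' j j)))) := by
  have : Nonempty (Fin n) := ⟨⟨0, hn0⟩⟩
  refine gronwall_horizon (D := fun k => Finset.expect Finset.univ
    (fun i : Fin T → Fin n => Finset.expect Finset.univ fun j =>
      ‖sgdIterate Ω g (fun _ => h) S i k - sgdIterate Ω g (fun _ => h) (S' j) i k‖ ^ 2))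
    ?_ ?_ ?_ hk
  · simp [sgdIterate]
  · intro s
    have : 0 ≤ Finset.expect Finset.univ (fun i : Fin T → Fin n =>
        Finset.expect Finset.univ fun j => f (sgdIterate Ω g (fun _ => h) S i s) (S j)
              + f (sgdIterate Ω g (fun _ => h) (S' j) i s) (S' j j)) :=
      Finset.expect_nonneg fun i _ => Finset.expect_nonneg fun j _ => add_nonneg (hf _ _) (hf _ _)
    positivity
  · intro k hk
    have hT : 0 < T := by omega
    have hT' : (0 : ℝ) < T := by positivity
    have hn' : (0 : ℝ) < n := by positivity
    set δ : (Fin T → Fin n) → Fin n → ℝ := fun i j =>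
      ‖sgdIterate Ω g (fun _ => h) S i k - sgdIterate Ω g (fun _ => h) (S' j) i k‖ ^ 2 with hδ
    set H : (Fin T → Fin n) → Fin n → ℝ := fun i j =>
      f (sgdIterate Ω g (fun _ => h) S i k) (S j)
              + f (sgdIterate Ω g (fun _ => h) (S' j) i k) (S' j j) with hH
    set A := 4 * (h * L) ^ (2 / (1 - α))
    set φ : Fin n → (Fin T → Fin n) → ℝ := fun j i =>
      n / T * δ i j + (1 + T / n) * (2 * h ^ 2 * q) * (2 * l + H i j) with hφ
    have step : ∀ i j,
        ‖sgdIterate Ω g (fun _ => h) S i (k + 1) - sgdIterate Ω g (fun _ => h) (S' j) i (k + 1)‖ ^ 2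
          ≤ δ i j + A + if i ⟨k, hk⟩ = j then φ j i else 0 := by
      intro i j
      -- The weight `p = n / T` times the probability `1 / n` is the growth rate `1 / T` that
      -- `gronwall_horizon` allows.
      refine (sgdIterate_stability hc hconv hn hα₀ hα₁ hL hsub hhol hh
        (p := (n : ℝ) / T) (by positivity) (hS j) i hk).trans ?_
      gcongr
      split_ifs with hij
      · rw [hφ]
        have h1 := hg (sgdIterate Ω g (fun _ => h) S i k) (S j)
        have h2 := hg (sgdIterate Ω g (fun _ => h) (S' j) i k) (S' j j)
        have h3 : (1 + ((n : ℝ) / T)⁻¹) * (2 * h ^ 2)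
            * (‖g (sgdIterate Ω g (fun _ => h) S i k) (S j)‖ ^ 2
              + ‖g (sgdIterate Ω g (fun _ => h) (S' j) i k) (S' j j)‖ ^ 2)
            ≤ (1 + T / n) * (2 * h ^ 2) * (q * (2 * l + H i j)) := by
          rw [inv_div]
          gcongr
          rw [hH]
          linarith
        simp only [hδ] at h3 ⊢
        linarith
      · exact le_rfl
    have hφu : ∀ j i a, φ j (Function.update i ⟨k, hk⟩ a) = φ j i := by
      intro j i a
      simp only [hφ, hδ, hH]
      rw [sgdIterate_update _ _ _ _ _ le_rfl, sgdIterate_update _ _ _ _ _ le_rfl]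
    calc Finset.expect Finset.univ (fun i : Fin T → Fin n => Finset.expect Finset.univ fun j =>
          ‖sgdIterate Ω g (fun _ => h) S i (k + 1)
            - sgdIterate Ω g (fun _ => h) (S' j) i (k + 1)‖ ^ 2)
        ≤ Finset.expect Finset.univ (fun i : Fin T → Fin n => Finset.expect Finset.univ fun j =>
            (δ i j + A + if i ⟨k, hk⟩ = j then φ j i else 0)) :=
          Finset.expect_le_expect fun i _ => Finset.expect_le_expect fun j _ => step i j
      _ = Finset.expect Finset.univ (fun i : Fin T → Fin n => Finset.expect Finset.univ (δ i)) + A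
          + Finset.expect Finset.univ (fun j : Fin n =>
            (n : ℝ)⁻¹ * Finset.expect Finset.univ (φ j)) := by
          have : Nonempty (Fin T → Fin n) := inferInstance
          simp only [Finset.expect_add_distrib, Fintype.expect_const]
          congr 1
          rw [Finset.expect_comm]
          exact Finset.expect_congr rfl fun j _ => expect_ite_index _ _ _ (hφu j)
      _ = (1 + (T : ℝ)⁻¹) * Finset.expect Finset.univ
            (fun i : Fin T → Fin n => Finset.expect Finset.univ (δ i))
          + (A + (1 + T / n) * (2 * h ^ 2 * q) / n * (2 * l + Finset.expect Finset.univ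
            (fun i : Fin T → Fin n => Finset.expect Finset.univ (H i)))) := by
          rw [← Finset.mul_expect, Finset.expect_comm Finset.univ Finset.univ φ]
          have : Nonempty (Fin T → Fin n) := inferInstance
          simp only [hφ, Finset.expect_add_distrib, ← Finset.mul_expect, Fintype.expect_const]
          field_simp
          ring

end Paths

/-! ### Finite averages under the integral, and exchange of an example -/

section Integration

theorem integrable_expect {ι X : Type*} [Fintype ι] [MeasurableSpace X] {μ : Measure X}
    {φ : ι → X → ℝ} (h : ∀ i, Integrable (φ i) μ) :
    Integrable (fun x => Finset.expect Finset.univ fun i => φ i x) μ := by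
  simp only [Fintype.expect_eq_sum_div_card]
  exact (integrable_finsetSum _ fun i _ => h i).div_const _

theorem integral_expect {ι X : Type*} [Fintype ι] [MeasurableSpace X] {μ : Measure X}
    {φ : ι → X → ℝ} (h : ∀ i, Integrable (φ i) μ) :
    ∫ x, Finset.expect Finset.univ (fun i => φ i x) ∂μ
      = Finset.expect Finset.univ fun i => ∫ x, φ i x ∂μ := by
  simp only [Fintype.expect_eq_sum_div_card]
  rw [integral_div, integral_finsetSum _ fun i _ => h i]

/-- Exchanging the `j`-th example of a sample with an independent copy preserves the law. -/
theorem measurePreserving_exchange {n : ℕ} {Z : Type*} [MeasurableSpace Z] (ρ : Measure Z)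
    [IsProbabilityMeasure ρ] (j : Fin n) :
    MeasurePreserving (fun x : (Fin n → Z) × Z => (Function.update x.1 j x.2, x.1 j))
      ((Measure.pi fun _ => ρ).prod ρ) ((Measure.pi fun _ => ρ).prod ρ) := by
  -- With the fresh copy attached as coordinate `0` of a sample of size `n + 1`, the exchange is the
  -- transposition of `0` and `j.succ`, which preserves the product measure.
  have h1 := (measurePreserving_piFinSuccAbove (fun _ : Fin (n + 1) => ρ) 0)
  have h2 := measurePreserving_piCongrLeft (fun _ : Fin (n + 1) => ρ) (Equiv.swap 0 j.succ)
  have h3 := ((h1.comp h2).comp h1.symm)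
  have h4 := (Measure.measurePreserving_swap.comp h3).comp
    (Measure.measurePreserving_swap (μ := (Measure.pi fun _ : Fin n => ρ)) (ν := ρ))
  convert h4 using 1
  funext x
  obtain ⟨S, z⟩ := x
  set Y : Fin (n + 1) → Z := (MeasurableEquiv.piFinSuccAbove (fun _ => Z) 0).symm (z, S) with hY
  have hYc : Y = Fin.cons z S := by
    rw [hY]; exact Fin.insertNth_zero (α := fun _ => Z) z S
  have e : ∀ m : Fin (n + 1), (MeasurableEquiv.piCongrLeft (fun _ : Fin (n + 1) => Z)
      (Equiv.swap 0 j.succ)) Y m = (Fin.cons z S : Fin (n + 1) → Z) (Equiv.swap 0 j.succ m) := by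
    intro m
    have := MeasurableEquiv.piCongrLeft_apply_apply (β := fun _ : Fin (n + 1) => Z)
      (Equiv.swap 0 j.succ) Y (Equiv.swap 0 j.succ m)
    rw [← hYc]
    rwa [Equiv.swap_apply_self] at this
  refine Prod.ext ?_ ?_
  · funext m
    change _ = (MeasurableEquiv.piCongrLeft (fun _ : Fin (n + 1) => Z)
      (Equiv.swap 0 j.succ)) Y m.succ
    rw [e]
    by_cases hm : m = j
    · subst hm; simp
    · rw [Equiv.swap_apply_of_ne_of_ne (Fin.succ_ne_zero m) (by simpa using hm)]
      simp [hm]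
  · change _ = (MeasurableEquiv.piCongrLeft (fun _ : Fin (n + 1) => Z)
      (Equiv.swap 0 j.succ)) Y 0
    rw [e]
    simp

end Integration

/-- The standing assumptions on the constraint set, the loss and its subgradients. -/
structure HolderSetting {d : ℕ} {Z : Type*} [MeasurableSpace Z] (α L : ℝ) (ρ : Measure Z)
    (Ω : Set (EuclideanSpace ℝ (Fin d))) (f : EuclideanSpace ℝ (Fin d) → Z → ℝ)
    (g : EuclideanSpace ℝ (Fin d) → Z → EuclideanSpace ℝ (Fin d)) : Prop where
  exponent_nonneg : 0 ≤ α
  exponent_lt_one : α < 1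
  const_nonneg : 0 ≤ L
  isClosed : IsClosed Ω
  convex : Convex ℝ Ω
  nonempty : Ω.Nonempty
  measurable_loss : Measurable (Function.uncurry f)
  measurable_subgradient : Measurable (Function.uncurry g)
  integrable_loss : ∀ w, Integrable (f w) ρ
  loss_nonneg : ∀ w z, 0 ≤ f w z
  subgradient : IsSubgradientSelection f g
  holder : IsHolderSubgradient α L g

/-! ### Measurability and integrability along the trajectory -/

namespace HolderSetting

variable {d : ℕ} {Z : Type*} [MeasurableSpace Z] {α L : ℝ} {ρ : Measure Z}
  {Ω : Set (EuclideanSpace ℝ (Fin d))} {f : EuclideanSpace ℝ (Fin d) → Z → ℝ}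
  {g : EuclideanSpace ℝ (Fin d) → Z → EuclideanSpace ℝ (Fin d)}

theorem self_bounding (hs : HolderSetting α L ρ Ω f g) {l : ℝ} (hl : 0 < l)
    (w : EuclideanSpace ℝ (Fin d)) (z : Z) :
    ‖g w z‖ ^ 2 ≤ (1 + L) ^ 2 * l ^ (-((1 - α) / (1 + α))) * (l + f w z) :=
  holder_subgradient_self_bounding (φ := fun w => f w z) (G := fun w => g w z)
    hs.exponent_nonneg hs.exponent_lt_one hs.const_nonneg (fun w v => hs.subgradient z w v)
    (fun w v => hs.holder w v z) (fun w => hs.loss_nonneg w z) hl w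

/-- Self-bounding at level `1` turns integrability of the loss at `0` into square integrability of
its subgradient, so no moment assumption on `g` is needed. -/
theorem memLp_subgradient_zero [IsProbabilityMeasure ρ] (hs : HolderSetting α L ρ Ω f g) :
    MemLp (g 0) 2 ρ := by
  have hm : AEStronglyMeasurable (g 0) ρ :=
    (hs.measurable_subgradient.comp (measurable_const.prodMk measurable_id)).aestronglyMeasurable
  rw [memLp_two_iff_integrable_sq_norm hm]
  refine Integrable.mono' (((integrable_const 1).add (hs.integrable_loss 0)).const_mul
    ((1 + L) ^ 2 * 1 ^ (-((1 - α) / (1 + α))))) (hm.norm.pow 2) (Filter.Eventually.of_forall ?_)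
  intro z
  rw [Real.norm_of_nonneg (by positivity)]
  exact hs.self_bounding one_pos 0 z

section RandomPoint

variable {X : Type*} [MeasurableSpace X] {μ : Measure X} [IsProbabilityMeasure μ]
  [IsProbabilityMeasure ρ] {W : X → EuclideanSpace ℝ (Fin d)} {ζ : X → Z}

/-- For `α < 1` Hölder continuity forces at most linear growth in the point. This is the induction
step for the square integrability of the iterates. -/
theorem memLp_subgradient (hs : HolderSetting α L ρ Ω f g) (hWm : Measurable W)
    (hW : MemLp W 2 μ) (hζ : MeasurePreserving ζ μ ρ) :
    MemLp (fun x => g (W x) (ζ x)) 2 μ := by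
  have hm : AEStronglyMeasurable (fun x => g (W x) (ζ x)) μ :=
    (hs.measurable_subgradient.comp (hWm.prodMk hζ.measurable)).aestronglyMeasurable
  have h0 : MemLp (fun x => g 0 (ζ x)) 2 μ :=
    hs.memLp_subgradient_zero.comp_measurePreserving hζ
  refine ((h0.norm.add ((memLp_const (1 : ℝ)).add hW.norm |>.const_mul L))).mono' hm
    (Filter.Eventually.of_forall fun x => ?_)
  have h1 := hs.holder (W x) 0 (ζ x)
  rw [sub_zero] at h1
  have h2 : ‖W x‖ ^ α ≤ 1 + ‖W x‖ := by
    rcases le_total ‖W x‖ 1 with h | h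
    · linarith [Real.rpow_le_one (norm_nonneg (W x)) h hs.exponent_nonneg, norm_nonneg (W x)]
    · have := Real.rpow_le_rpow_of_exponent_le h hs.exponent_lt_one.le
      rw [Real.rpow_one] at this
      linarith
  have h3 : L * ‖W x‖ ^ α ≤ L * (1 + ‖W x‖) := mul_le_mul_of_nonneg_left h2 hs.const_nonneg
  have h4 : ‖g (W x) (ζ x)‖ ≤ ‖g 0 (ζ x)‖ + ‖g (W x) (ζ x) - g 0 (ζ x)‖ := by
    simpa using norm_add_le (g 0 (ζ x)) (g (W x) (ζ x) - g 0 (ζ x))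
  simp only [Pi.add_apply]
  linarith

/-- By convexity the loss is at most the loss at `0` plus `‖g‖ * ‖W‖`, a product of two square
integrable functions. -/
theorem integrable_loss_comp (hs : HolderSetting α L ρ Ω f g) (hWm : Measurable W)
    (hW : MemLp W 2 μ) (hζ : MeasurePreserving ζ μ ρ) :
    Integrable (fun x => f (W x) (ζ x)) μ := by
  have hm : AEStronglyMeasurable (fun x => f (W x) (ζ x)) μ :=
    (hs.measurable_loss.comp (hWm.prodMk hζ.measurable)).aestronglyMeasurable
  have h0 : Integrable (fun x => f 0 (ζ x)) μ :=
    hζ.integrable_comp_of_integrable (hs.integrable_loss 0)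
  have h1 : Integrable (fun x => ‖g (W x) (ζ x)‖ * ‖W x‖) μ :=
    (hs.memLp_subgradient hWm hW hζ).norm.integrable_mul hW.norm
  refine (h0.add h1).mono' hm (Filter.Eventually.of_forall fun x => ?_)
  rw [Real.norm_of_nonneg (hs.loss_nonneg _ _)]
  have h2 := hs.subgradient (ζ x) (W x) 0
  have h3 := real_inner_le_norm (g (W x) (ζ x)) (W x)
  rw [zero_sub, inner_neg_right] at h2
  simp only [Pi.add_apply]
  linarith

end RandomPoint

section Iterates

variable {n T : ℕ}

theorem populationRisk_nonneg (hs : HolderSetting α L ρ Ω f g) (w : EuclideanSpace ℝ (Fin d)) :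
    0 ≤ populationRisk ρ f w := integral_nonneg fun z => hs.loss_nonneg w z

theorem measurable_sgdIterate (hs : HolderSetting α L ρ Ω f g) (η : ℕ → ℝ) (i : Fin T → Fin n)
    (k : ℕ) : Measurable fun S : Fin n → Z => sgdIterate Ω g η S i k := by
  induction k with
  | zero => exact measurable_const
  | succ k ih =>
    by_cases hk : k < T
    · simp only [sgdIterate_succ η _ i hk]
      refine (continuous_projOn hs.isClosed hs.convex hs.nonempty).measurable.comp ?_
      have h1 : Measurable fun S : Fin n → Z =>
          g (sgdIterate Ω g η S i k) (S (i ⟨k, hk⟩)) :=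
        hs.measurable_subgradient.comp (ih.prodMk (measurable_pi_apply _))
      exact ih.sub (h1.const_smul (η (k + 1)))
    · simpa [sgdIterate, hk] using ih

theorem measurable_sgdAverage (hs : HolderSetting α L ρ Ω f g) (η : ℕ → ℝ) (i : Fin T → Fin n) :
    Measurable fun S : Fin n → Z => sgdAverage Ω g η S i := by
  unfold sgdAverage
  exact (Finset.measurable_fun_sum _ fun k _ =>
    (hs.measurable_sgdIterate η i k).const_smul (η (k + 1))).const_smul
      (∑ k ∈ Finset.range T, η (k + 1))⁻¹

variable [IsProbabilityMeasure ρ]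

theorem memLp_sgdIterate (hs : HolderSetting α L ρ Ω f g) (η : ℕ → ℝ) (i : Fin T → Fin n)
    (k : ℕ) :
    MemLp (fun S : Fin n → Z => sgdIterate Ω g η S i k) 2 (Measure.pi fun _ => ρ) := by
  induction k with
  | zero => exact memLp_const _
  | succ k ih =>
    by_cases hk : k < T
    · have h1 := ih.sub ((hs.memLp_subgradient (hs.measurable_sgdIterate η i k) ih
        (measurePreserving_eval (fun _ => ρ) (i ⟨k, hk⟩))).const_smul (η (k + 1)))
      refine (h1.norm.add (memLp_const ‖projOn Ω 0‖)).mono'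
        (hs.measurable_sgdIterate η i (k + 1)).aestronglyMeasurable
        (Filter.Eventually.of_forall fun S => ?_)
      rw [sgdIterate_succ η _ i hk]
      set x := sgdIterate Ω g η S i k - η (k + 1) • g (sgdIterate Ω g η S i k) (S (i ⟨k, hk⟩))
        with hx
      have h2 := norm_projOn_sub_projOn_le hs.isClosed hs.convex hs.nonempty x 0
      have h3 : ‖projOn Ω x‖ ≤ ‖projOn Ω x - projOn Ω 0‖ + ‖projOn Ω 0‖ := by
        simpa using norm_add_le (projOn Ω x - projOn Ω 0) (projOn Ω 0)
      rw [sub_zero] at h2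
      exact h3.trans (add_le_add_left h2 _)
    · simpa [sgdIterate, hk] using ih

theorem memLp_sgdAverage (hs : HolderSetting α L ρ Ω f g) (η : ℕ → ℝ) (i : Fin T → Fin n) :
    MemLp (fun S : Fin n → Z => sgdAverage Ω g η S i) 2 (Measure.pi fun _ => ρ) := by
  unfold sgdAverage
  exact (memLp_finsetSum _ fun k _ =>
    (hs.memLp_sgdIterate η i k).const_smul (η (k + 1))).const_smul
      (∑ k ∈ Finset.range T, η (k + 1))⁻¹

theorem integrable_loss_sgdIterate (hs : HolderSetting α L ρ Ω f g) (η : ℕ → ℝ)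
    (i : Fin T → Fin n) (k : ℕ) (j : Fin n) :
    Integrable (fun S : Fin n → Z => f (sgdIterate Ω g η S i k) (S j))
      (Measure.pi fun _ => ρ) :=
  hs.integrable_loss_comp (hs.measurable_sgdIterate η i k) (hs.memLp_sgdIterate η i k)
    (measurePreserving_eval (fun _ => ρ) j)

theorem integrable_loss_sgdAverage_fresh (hs : HolderSetting α L ρ Ω f g) (η : ℕ → ℝ)
    (i : Fin T → Fin n) :
    Integrable (fun x : (Fin n → Z) × Z => f (sgdAverage Ω g η x.1 i) x.2)
      ((Measure.pi fun _ => ρ).prod ρ) :=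
  hs.integrable_loss_comp ((hs.measurable_sgdAverage η i).comp measurable_fst)
    ((hs.memLp_sgdAverage η i).comp_measurePreserving measurePreserving_fst)
    measurePreserving_snd

theorem integrable_populationRisk_sgdAverage (hs : HolderSetting α L ρ Ω f g) (η : ℕ → ℝ)
    (i : Fin T → Fin n) :
    Integrable (fun S : Fin n → Z => populationRisk ρ f (sgdAverage Ω g η S i))
      (Measure.pi fun _ => ρ) :=
  (hs.integrable_loss_sgdAverage_fresh η i).integral_prod_left

theorem integral_populationRisk_sgdAverage (hs : HolderSetting α L ρ Ω f g) (η : ℕ → ℝ)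
    (i : Fin T → Fin n) :
    ∫ x : (Fin n → Z) × Z, f (sgdAverage Ω g η x.1 i) x.2 ∂((Measure.pi fun _ => ρ).prod ρ)
      = ∫ S : Fin n → Z, populationRisk ρ f (sgdAverage Ω g η S i) ∂(Measure.pi fun _ => ρ) :=
  integral_prod _ (hs.integrable_loss_sgdAverage_fresh η i)

end Iterates

end HolderSetting

/-! ### Expected training loss and expected stability -/

section Means

variable {d : ℕ} {Z : Type*} [MeasurableSpace Z]

/-- The expected training loss of the `(k+1)`-st iterate of SGD with constant step `h`. -/
noncomputable def meanTrainingLoss (ρ : Measure Z) (Ω : Set (EuclideanSpace ℝ (Fin d)))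
    (f : EuclideanSpace ℝ (Fin d) → Z → ℝ)
    (g : EuclideanSpace ℝ (Fin d) → Z → EuclideanSpace ℝ (Fin d)) (h : ℝ) (n T k : ℕ) : ℝ :=
  Finset.expect Finset.univ fun i : Fin T → Fin n => Finset.expect Finset.univ fun j =>
    ∫ S : Fin n → Z, f (sgdIterate Ω g (fun _ => h) S i k) (S j) ∂(Measure.pi fun _ => ρ)

/-- The expected squared distance of the averaged iterate of SGD to that of a run on the sample
with one example replaced by an independent copy, averaged over the replaced position. -/
noncomputable def meanStability (ρ : Measure Z) (Ω : Set (EuclideanSpace ℝ (Fin d)))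
    (g : EuclideanSpace ℝ (Fin d) → Z → EuclideanSpace ℝ (Fin d)) (h : ℝ) (n T : ℕ) : ℝ :=
  Finset.expect Finset.univ fun i : Fin T → Fin n => Finset.expect Finset.univ fun j =>
    ∫ x : (Fin n → Z) × Z, ‖sgdAverage Ω g (fun _ => h) (Function.update x.1 j x.2) i
      - sgdAverage Ω g (fun _ => h) x.1 i‖ ^ 2 ∂((Measure.pi fun _ => ρ).prod ρ)

theorem expectedRisk_eq_expect (ρ : Measure Z) (Ω : Set (EuclideanSpace ℝ (Fin d)))
    (f : EuclideanSpace ℝ (Fin d) → Z → ℝ)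
    (g : EuclideanSpace ℝ (Fin d) → Z → EuclideanSpace ℝ (Fin d)) (η : ℕ → ℝ) (n T : ℕ) :
    expectedRisk ρ Ω f g η n T = Finset.expect Finset.univ fun i : Fin T → Fin n =>
      ∫ S : Fin n → Z, populationRisk ρ f (sgdAverage Ω g η S i) ∂(Measure.pi fun _ => ρ) := by
  rw [expectedRisk, Fintype.expect_eq_sum_div_card]
  simp only [Fintype.card_pi, Fintype.card_fin, Finset.prod_const, Finset.card_univ,
    Nat.cast_pow]
  rw [div_eq_inv_mul]

end Means

/-! ### Passing pointwise affine inequalities to expectations -/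

section IntegratedInequalities

variable {X : Type*} [MeasurableSpace X] {μ : Measure X} [IsProbabilityMeasure μ]

theorem integral_progress_le {a b c e : X → ℝ} {r s l : ℝ} (ha : Integrable a μ)
    (hb : Integrable b μ) (hc : Integrable c μ) (he : Integrable e μ)
    (h : ∀ x, r * (a x - b x) ≤ c x - e x + s * (l + a x)) :
    r * (∫ x, a x ∂μ - ∫ x, b x ∂μ)
      ≤ ∫ x, c x ∂μ - ∫ x, e x ∂μ + s * (l + ∫ x, a x ∂μ) := by
  have i1 : Integrable (fun x => r * (a x - b x)) μ := (ha.sub hb).const_mul r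
  have i2 : Integrable (fun x => c x - e x) μ := hc.sub he
  have i3 : Integrable (fun x => s * (l + a x)) μ := ((integrable_const l).add ha).const_mul s
  have := integral_mono i1 (g := fun x => c x - e x + s * (l + a x)) (i2.add i3) h
  rw [integral_add i2 i3, integral_const_mul, integral_const_mul, integral_sub ha hb,
    integral_sub hc he, integral_add (integrable_const l) ha, integral_const] at this
  simpa using this

theorem integral_stability_le {ι : Type*} {I : Finset ι} {δ : X → ℝ} {φ : ι → X → ℝ}
    {C A B m : ℝ} (hδ : Integrable δ μ) (hφ : ∀ s, Integrable (φ s) μ)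
    (h : ∀ x, δ x ≤ C * ∑ s ∈ I, (A + B * (m + φ s x))) :
    ∫ x, δ x ∂μ ≤ C * ∑ s ∈ I, (A + B * (m + ∫ x, φ s x ∂μ)) := by
  have i1 : ∀ s, Integrable (fun x => B * (m + φ s x)) μ := fun s =>
    ((integrable_const m).add (hφ s)).const_mul B
  have i2 : ∀ s, Integrable (fun x => A + B * (m + φ s x)) μ := fun s =>
    (integrable_const A).add (i1 s)
  have i3 : Integrable (fun x => ∑ s ∈ I, (A + B * (m + φ s x))) μ :=
    integrable_finsetSum _ fun s _ => i2 s
  refine (integral_mono hδ (i3.const_mul C) h).trans_eq ?_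
  rw [integral_const_mul, integral_finsetSum _ fun s _ => i2 s]
  congr 1
  refine Finset.sum_congr rfl fun s _ => ?_
  rw [integral_add (integrable_const A) (i1 s), integral_const_mul,
    integral_add (integrable_const m) (hφ s)]
  simp

theorem integral_generalization_le {ι : Type*} {I : Finset ι} {b e : X → ℝ} {φ : ι → X → ℝ}
    {t r l u : ℝ} (hb : Integrable b μ) (he : Integrable e μ) (hφ : ∀ s, Integrable (φ s) μ)
    (h : ∀ x, b x ≤ t * ∑ s ∈ I, φ s x + r * (l + b x) + u * e x) :
    ∫ x, b x ∂μ ≤ t * ∑ s ∈ I, ∫ x, φ s x ∂μ + r * (l + ∫ x, b x ∂μ) + u * ∫ x, e x ∂μ := by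
  have i1 : Integrable (fun x => t * ∑ s ∈ I, φ s x) μ :=
    (integrable_finsetSum _ fun s _ => hφ s).const_mul t
  have i2 : Integrable (fun x => r * (l + b x)) μ := ((integrable_const l).add hb).const_mul r
  have i3 : Integrable (fun x => u * e x) μ := he.const_mul u
  have i4 : Integrable (fun x => t * ∑ s ∈ I, φ s x + r * (l + b x)) μ := i1.add i2
  refine (integral_mono hb (i4.add i3) h).trans_eq ?_
  change ∫ x, (t * ∑ s ∈ I, φ s x + r * (l + b x) + u * e x) ∂μ = _
  rw [integral_add i4 i3, integral_add i1 i2, integral_const_mul, integral_const_mul,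
    integral_const_mul, integral_finsetSum _ fun s _ => hφ s,
    integral_add (integrable_const l) hb]
  simp

end IntegratedInequalities

/-! ### Optimization, stability and generalization in expectation -/

namespace HolderSetting

variable {d : ℕ} {Z : Type*} [MeasurableSpace Z] {α L : ℝ} {ρ : Measure Z}
  {Ω : Set (EuclideanSpace ℝ (Fin d))} {f : EuclideanSpace ℝ (Fin d) → Z → ℝ}
  {g : EuclideanSpace ℝ (Fin d) → Z → EuclideanSpace ℝ (Fin d)} {n T : ℕ} {h q l : ℝ}

theorem meanTrainingLoss_nonneg (hs : HolderSetting α L ρ Ω f g) (k : ℕ) :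
    0 ≤ meanTrainingLoss ρ Ω f g h n T k :=
  Finset.expect_nonneg fun _ _ => Finset.expect_nonneg fun _ _ =>
    integral_nonneg fun _ => hs.loss_nonneg _ _

/-- Among the averaged iterates only the initial `0` may lie outside `Ω`. Adding `v / T` replaces it
by `v`, which leaves a convex combination of points of `Ω`. -/
theorem average_add_mem (hs : HolderSetting α L ρ Ω f g) (hh : h ≠ 0) (hT : 0 < T)
    {v : EuclideanSpace ℝ (Fin d)} (hv : v ∈ Ω) (S : Fin n → Z) (i : Fin T → Fin n) :
    sgdAverage Ω g (fun _ => h) S i + (T : ℝ)⁻¹ • v ∈ Ω := by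
  have hT' : (T : ℝ) ≠ 0 := by positivity
  have h1 : sgdAverage Ω g (fun _ => h) S i + (T : ℝ)⁻¹ • v = ∑ k ∈ Finset.range T,
      (T : ℝ)⁻¹ • (sgdIterate Ω g (fun _ => h) S i k + if k = 0 then v else 0) := by
    rw [sgdAverage_const hh, ← Finset.smul_sum, Finset.sum_add_distrib, smul_add,
      Finset.sum_ite_eq' (Finset.range T) 0 fun _ => v, if_pos (Finset.mem_range.2 hT)]
  rw [h1]
  refine hs.convex.sum_mem (fun _ _ => by positivity) (by simp [hT']) fun k hk => ?_
  cases k with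
  | zero => simpa [sgdIterate] using hv
  | succ k =>
    simpa using sgdIterate_mem hs.isClosed hs.nonempty (fun _ => h) S i
      (by have := Finset.mem_range.1 hk; omega)

theorem expectedRisk_nonneg (hs : HolderSetting α L ρ Ω f g) (η : ℕ → ℝ) :
    0 ≤ expectedRisk ρ Ω f g η n T := by
  rw [expectedRisk_eq_expect]
  exact Finset.expect_nonneg fun i _ => integral_nonneg fun S => hs.populationRisk_nonneg _

variable [IsProbabilityMeasure ρ]

theorem integral_loss_eval (hs : HolderSetting α L ρ Ω f g) (v : EuclideanSpace ℝ (Fin d))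
    (j : Fin n) :
    ∫ S : Fin n → Z, f v (S j) ∂(Measure.pi fun _ => ρ) = populationRisk ρ f v := by
  have hm := measurePreserving_eval (fun _ : Fin n => ρ) j
  have := integral_map hm.measurable.aemeasurable (f := f v) (μ := Measure.pi fun _ => ρ)
    (by rw [hm.map_eq]; exact (hs.integrable_loss v).aestronglyMeasurable)
  rw [hm.map_eq] at this
  exact this.symm

/-- Optimization error bound for projected SGD with constant step. -/
theorem optimization_bound (hs : HolderSetting α L ρ Ω f g) (hh : 0 ≤ h)
    (hg : ∀ w z, ‖g w z‖ ^ 2 ≤ q * (l + f w z)) (hn : 0 < n)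
    {v : EuclideanSpace ℝ (Fin d)} (hv : v ∈ Ω) :
    2 * h * ∑ k ∈ Finset.range T, (meanTrainingLoss ρ Ω f g h n T k - populationRisk ρ f v)
      ≤ ‖v‖ ^ 2
        + h ^ 2 * q * ∑ k ∈ Finset.range T, (l + meanTrainingLoss ρ Ω f g h n T k) := by
  have : Nonempty (Fin n) := ⟨⟨0, hn⟩⟩
  set V : ℕ → ℝ := fun k => Finset.expect Finset.univ fun i : Fin T → Fin n =>
    ∫ S : Fin n → Z, ‖sgdIterate Ω g (fun _ => h) S i k - v‖ ^ 2 ∂(Measure.pi fun _ => ρ) with hV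
  have hVint : ∀ (i : Fin T → Fin n) (k : ℕ), Integrable (fun S : Fin n → Z =>
      ‖sgdIterate Ω g (fun _ => h) S i k - v‖ ^ 2) (Measure.pi fun _ => ρ) := fun i k =>
    ((hs.memLp_sgdIterate _ i k).sub (memLp_const v)).norm.integrable_sq
  have hstep : ∀ k ∈ Finset.range T,
      2 * h * (meanTrainingLoss ρ Ω f g h n T k - populationRisk ρ f v)
        ≤ V k - V (k + 1) + h ^ 2 * q * (l + meanTrainingLoss ρ Ω f g h n T k) := by
    intro k hk
    have hk := Finset.mem_range.1 hk
    set Y : (Fin T → Fin n) → Fin n → ℝ := fun i j =>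
      ∫ S : Fin n → Z, f (sgdIterate Ω g (fun _ => h) S i k) (S j) ∂(Measure.pi fun _ => ρ)
      with hY
    -- The iterate does not depend on the index drawn at its own step, so the drawn example may be
    -- averaged over the whole sample.
    have hYm : Finset.expect Finset.univ (fun i => Y i (i ⟨k, hk⟩))
        = meanTrainingLoss ρ Ω f g h n T k := by
      refine expect_apply_index ⟨k, hk⟩ Y fun i a => ?_
      funext j
      simp only [hY, sgdIterate_update _ _ _ ⟨k, hk⟩ _ le_rfl]
    have hpt : ∀ i : Fin T → Fin n, 2 * h * (Y i (i ⟨k, hk⟩) - populationRisk ρ f v)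
        ≤ (∫ S : Fin n → Z, ‖sgdIterate Ω g (fun _ => h) S i k - v‖ ^ 2
            ∂(Measure.pi fun _ => ρ))
          - (∫ S : Fin n → Z, ‖sgdIterate Ω g (fun _ => h) S i (k + 1) - v‖ ^ 2
            ∂(Measure.pi fun _ => ρ)) + h ^ 2 * q * (l + Y i (i ⟨k, hk⟩)) := by
      intro i
      have i1 := hs.integrable_loss_sgdIterate (fun _ => h) i k (i ⟨k, hk⟩)
      have i2 : Integrable (fun S : Fin n → Z => f v (S (i ⟨k, hk⟩)))
          (Measure.pi fun _ => ρ) :=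
        (measurePreserving_eval (fun _ : Fin n => ρ) (i ⟨k, hk⟩)).integrable_comp_of_integrable
          (hs.integrable_loss v)
      rw [← hs.integral_loss_eval v (i ⟨k, hk⟩)]
      refine integral_progress_le i1 i2 (hVint i k) (hVint i (k + 1)) fun S => ?_
      refine (sgdIterate_progress hs.isClosed hs.convex hs.subgradient hh hv S i hk).trans ?_
      have := hg (sgdIterate Ω g (fun _ => h) S i k) (S (i ⟨k, hk⟩))
      have := mul_le_mul_of_nonneg_left this (sq_nonneg h)
      linarith
    have hne : Nonempty (Fin T → Fin n) := inferInstance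
    have := Finset.expect_le_expect (s := Finset.univ) fun i (_ : i ∈ Finset.univ) => hpt i
    simpa only [Finset.expect_add_distrib, Finset.expect_sub_distrib, ← Finset.mul_expect,
      Fintype.expect_const, hYm] using this
  have hsum := Finset.sum_le_sum hstep
  rw [← Finset.mul_sum, Finset.sum_add_distrib, Finset.sum_range_sub', ← Finset.mul_sum] at hsum
  have hV0 : V 0 = ‖v‖ ^ 2 := by
    simp [hV, sgdIterate]
  have hVT : 0 ≤ V T := Finset.expect_nonneg fun i _ => integral_nonneg fun S => by positivity
  linarith

theorem integrable_exchange {φ : (Fin n → Z) × Z → ℝ}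
    (j : Fin n) (hφ : Integrable φ ((Measure.pi fun _ => ρ).prod ρ)) :
    Integrable (fun x : (Fin n → Z) × Z => φ (Function.update x.1 j x.2, x.1 j))
      ((Measure.pi fun _ => ρ).prod ρ) :=
  (measurePreserving_exchange ρ j).integrable_comp_of_integrable hφ

theorem integral_exchange {φ : (Fin n → Z) × Z → ℝ}
    (j : Fin n) (hφ : Integrable φ ((Measure.pi fun _ => ρ).prod ρ)) :
    ∫ x : (Fin n → Z) × Z, φ (Function.update x.1 j x.2, x.1 j) ∂((Measure.pi fun _ => ρ).prod ρ)
      = ∫ x, φ x ∂((Measure.pi fun _ => ρ).prod ρ) := by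
  have hm := measurePreserving_exchange ρ j
  have := integral_map hm.measurable.aemeasurable (f := φ)
    (μ := (Measure.pi fun _ => ρ).prod ρ) (by rw [hm.map_eq]; exact hφ.aestronglyMeasurable)
  rw [hm.map_eq] at this
  exact this.symm

theorem integrable_fst {φ : (Fin n → Z) → ℝ} (hφ : Integrable φ (Measure.pi fun _ => ρ)) :
    Integrable (fun x : (Fin n → Z) × Z => φ x.1) ((Measure.pi fun _ => ρ).prod ρ) :=
  (measurePreserving_fst (μ := Measure.pi fun _ => ρ) (ν := ρ)).integrable_comp_of_integrable hφ

theorem integral_fst {φ : (Fin n → Z) → ℝ} :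
    ∫ x : (Fin n → Z) × Z, φ x.1 ∂((Measure.pi fun _ => ρ).prod ρ)
      = ∫ S, φ S ∂(Measure.pi fun _ => ρ) := by
  rw [integral_fun_fst]; simp

theorem integrable_norm_sgdAverage_exchange_sub_sq (hs : HolderSetting α L ρ Ω f g) (η : ℕ → ℝ)
    (i : Fin T → Fin n) (j : Fin n) :
    Integrable (fun x : (Fin n → Z) × Z => ‖sgdAverage Ω g η (Function.update x.1 j x.2) i
      - sgdAverage Ω g η x.1 i‖ ^ 2) ((Measure.pi fun _ => ρ).prod ρ) := by
  have m1 : MemLp (fun x : (Fin n → Z) × Z => sgdAverage Ω g η x.1 i) 2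
      ((Measure.pi fun _ => ρ).prod ρ) :=
    (hs.memLp_sgdAverage η i).comp_measurePreserving measurePreserving_fst
  have m2 := m1.comp_measurePreserving (measurePreserving_exchange ρ j)
  have m3 := (m2.sub m1).norm.integrable_sq
  exact m3

/-- On-average stability bound for the averaged iterate. -/
theorem stability_bound (hs : HolderSetting α L ρ Ω f g) (hh : 0 < h) (hl : 0 ≤ l) (hq : 0 ≤ q)
    (hg : ∀ w z, ‖g w z‖ ^ 2 ≤ q * (l + f w z)) (hn : 0 < n) :
    meanStability ρ Ω g h n T ≤ Real.exp 1 * ∑ k ∈ Finset.range T,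
      (4 * (h * L) ^ (2 / (1 - α)) + (1 + T / n) * (2 * h ^ 2 * q) / n
        * (2 * l + 2 * meanTrainingLoss ρ Ω f g h n T k)) := by
  have : Nonempty (Fin n) := ⟨⟨0, hn⟩⟩
  have hne : Nonempty (Fin T → Fin n) := inferInstance
  set P : Measure ((Fin n → Z) × Z) := (Measure.pi fun _ => ρ).prod ρ
  set A := 4 * (h * L) ^ (2 / (1 - α)) with hA
  set B := (1 + T / n) * (2 * h ^ 2 * q) / n with hB
  have hBnn : 0 ≤ B := by positivity
  have hAnn : 0 ≤ A := by have := hs.const_nonneg; positivity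
  set H1 : ℕ → (Fin T → Fin n) → Fin n → (Fin n → Z) × Z → ℝ := fun s i j x =>
    f (sgdIterate Ω g (fun _ => h) x.1 i s) (x.1 j) with hH1
  have hH1int : ∀ s i j, Integrable (H1 s i j) P := fun s i j =>
    integrable_fst (hs.integrable_loss_sgdIterate (fun _ => h) i s j)
  set H2 : ℕ → (Fin T → Fin n) → Fin n → (Fin n → Z) × Z → ℝ := fun s i j x =>
    f (sgdIterate Ω g (fun _ => h) (Function.update x.1 j x.2) i s)
      (Function.update x.1 j x.2 j) with hH2
  have hH2int : ∀ s i j, Integrable (H2 s i j) P := fun s i j =>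
    integrable_exchange j (hH1int s i j)
  -- By exchangeability the perturbed run has the same expected loss on its own training example.
  have hH2eq : ∀ s i j, ∫ x, H2 s i j x ∂P = ∫ x, H1 s i j x ∂P := fun s i j =>
    integral_exchange j (hH1int s i j)
  have hH1eq : ∀ s i j, ∫ x, H1 s i j x ∂P
      = ∫ S : Fin n → Z, f (sgdIterate Ω g (fun _ => h) S i s) (S j) ∂(Measure.pi fun _ => ρ) :=
    fun s i j => integral_fst (φ := fun S : Fin n → Z => f (sgdIterate Ω g (fun _ => h) S i s) (S j))
  set Hs : ℕ → (Fin n → Z) × Z → ℝ := fun s x => Finset.expect Finset.univ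
    fun i : Fin T → Fin n => Finset.expect Finset.univ fun j => H1 s i j x + H2 s i j x with hHs
  have hHsint : ∀ s, Integrable (Hs s) P := fun s =>
    integrable_expect fun i => integrable_expect fun j => (hH1int s i j).add (hH2int s i j)
  have hHseq : ∀ s, ∫ x, Hs s x ∂P = 2 * meanTrainingLoss ρ Ω f g h n T s := by
    intro s
    have e1 : ∀ i j, ∫ x, (H1 s i j x + H2 s i j x) ∂P
        = 2 * ∫ S : Fin n → Z, f (sgdIterate Ω g (fun _ => h) S i s) (S j)
          ∂(Measure.pi fun _ => ρ) := by
      intro i j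
      rw [integral_add (hH1int s i j) (hH2int s i j), hH2eq, hH1eq, two_mul]
    have e2 : ∀ i : Fin T → Fin n,
        ∫ x, Finset.expect Finset.univ (fun j => H1 s i j x + H2 s i j x) ∂P
          = Finset.expect Finset.univ fun j => ∫ x, (H1 s i j x + H2 s i j x) ∂P := fun i =>
      integral_expect fun j => (hH1int s i j).add (hH2int s i j)
    have e3 : ∫ x, Hs s x ∂P = Finset.expect Finset.univ fun i : Fin T → Fin n =>
        ∫ x, Finset.expect Finset.univ (fun j => H1 s i j x + H2 s i j x) ∂P :=
      integral_expect fun i => integrable_expect fun j => (hH1int s i j).add (hH2int s i j)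
    rw [e3]
    simp only [e2, e1, ← Finset.mul_expect]
    rfl
  set Δ : (Fin n → Z) × Z → ℝ := fun x => Finset.expect Finset.univ
    fun i : Fin T → Fin n => Finset.expect Finset.univ fun j =>
      ‖sgdAverage Ω g (fun _ => h) (Function.update x.1 j x.2) i
        - sgdAverage Ω g (fun _ => h) x.1 i‖ ^ 2 with hΔ
  have hΔint0 : ∀ (i : Fin T → Fin n) (j : Fin n), Integrable (fun x : (Fin n → Z) × Z =>
      ‖sgdAverage Ω g (fun _ => h) (Function.update x.1 j x.2) i
        - sgdAverage Ω g (fun _ => h) x.1 i‖ ^ 2) P := fun i j =>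
    hs.integrable_norm_sgdAverage_exchange_sub_sq (fun _ => h) i j
  have hΔint : Integrable Δ P := integrable_expect fun i => integrable_expect fun j => hΔint0 i j
  have hΔeq : ∫ x, Δ x ∂P = meanStability ρ Ω g h n T := by
    rw [hΔ, integral_expect fun i => integrable_expect fun j => hΔint0 i j]
    exact Finset.expect_congr rfl fun i _ => integral_expect fun j => hΔint0 i j
  have hpt : ∀ x, Δ x ≤ Real.exp 1 * ∑ s ∈ Finset.range T, (A + B * (2 * l + Hs s x)) := by
    intro x
    have hstab : ∀ k ∈ Finset.range T, Finset.expect Finset.univ (fun i : Fin T → Fin n =>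
        Finset.expect Finset.univ fun j => ‖sgdIterate Ω g (fun _ => h) x.1 i k
          - sgdIterate Ω g (fun _ => h) (Function.update x.1 j x.2) i k‖ ^ 2)
        ≤ Real.exp 1 * ∑ s ∈ Finset.range T, (A + B * (2 * l + Hs s x)) := fun k hk =>
      sgdIterate_average_stability hs.isClosed hs.convex hs.nonempty hs.exponent_nonneg
        hs.exponent_lt_one hs.const_nonneg hs.loss_nonneg hs.subgradient hs.holder hh.le hl hq hg
        hn (S' := fun j => Function.update x.1 j x.2)
        (fun j m hm => Function.update_of_ne hm _ _) (Finset.mem_range.1 hk).le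
    calc Δ x ≤ Finset.expect Finset.univ fun i : Fin T → Fin n =>
          Finset.expect Finset.univ fun j : Fin n => (T : ℝ)⁻¹ * ∑ k ∈ Finset.range T,
            ‖sgdIterate Ω g (fun _ => h) x.1 i k
              - sgdIterate Ω g (fun _ => h) (Function.update x.1 j x.2) i k‖ ^ 2 :=
          Finset.expect_le_expect fun i _ => Finset.expect_le_expect fun j _ =>
            norm_sgdAverage_sub_sq_le hh.ne' _ _ i
      _ = (T : ℝ)⁻¹ * ∑ k ∈ Finset.range T, Finset.expect Finset.univ
            fun i : Fin T → Fin n => Finset.expect Finset.univ fun j : Fin n =>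
            ‖sgdIterate Ω g (fun _ => h) x.1 i k
              - sgdIterate Ω g (fun _ => h) (Function.update x.1 j x.2) i k‖ ^ 2 := by
          simp only [← Finset.mul_expect, Finset.expect_sum_comm]
      _ ≤ (T : ℝ)⁻¹ * ∑ k ∈ Finset.range T,
            (Real.exp 1 * ∑ s ∈ Finset.range T, (A + B * (2 * l + Hs s x))) := by
          gcongr with k hk; exact hstab k hk
      _ ≤ _ := by
          rw [Finset.sum_const, Finset.card_range, nsmul_eq_mul, ← mul_assoc]
          -- Only `T⁻¹ * T ≤ 1` is available, since `T = 0` is not excluded here.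
          refine mul_le_of_le_one_left ?_ ?_
          · refine mul_nonneg (Real.exp_nonneg _) (Finset.sum_nonneg fun s _ => ?_)
            have : 0 ≤ Hs s x := Finset.expect_nonneg fun i _ => Finset.expect_nonneg fun j _ =>
              add_nonneg (hs.loss_nonneg _ _) (hs.loss_nonneg _ _)
            positivity
          · rw [mul_comm]; exact mul_inv_le_one
  rw [← hΔeq]
  simpa only [hHseq] using integral_stability_le hΔint hHsint hpt

/-- The generalization gap of the averaged iterate is controlled by on-average stability. -/
theorem generalization_bound (hs : HolderSetting α L ρ Ω f g) (hh : 0 < h)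
    (hg : ∀ w z, ‖g w z‖ ^ 2 ≤ q * (l + f w z)) (hn : 0 < n) (hT : 0 < T) {γ : ℝ} (hγ : 0 < γ) :
    expectedRisk ρ Ω f g (fun _ => h) n T
      ≤ (T : ℝ)⁻¹ * ∑ k ∈ Finset.range T, meanTrainingLoss ρ Ω f g h n T k
        + q / (2 * γ) * (l + expectedRisk ρ Ω f g (fun _ => h) n T)
        + γ / 2 * meanStability ρ Ω g h n T := by
  have : Nonempty (Fin n) := ⟨⟨0, hn⟩⟩
  have hne : Nonempty (Fin T → Fin n) := inferInstance
  set P : Measure ((Fin n → Z) × Z) := (Measure.pi fun _ => ρ).prod ρ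
  set Y : (Fin T → Fin n) → ℝ := fun i => ∫ S : Fin n → Z,
    populationRisk ρ f (sgdAverage Ω g (fun _ => h) S i) ∂(Measure.pi fun _ => ρ) with hY
  set Δ : (Fin T → Fin n) → Fin n → ℝ := fun i j => ∫ x : (Fin n → Z) × Z,
    ‖sgdAverage Ω g (fun _ => h) (Function.update x.1 j x.2) i
      - sgdAverage Ω g (fun _ => h) x.1 i‖ ^ 2 ∂P with hΔ
  have key : ∀ i j, Y i ≤ (T : ℝ)⁻¹ * ∑ k ∈ Finset.range T,
      (∫ S : Fin n → Z, f (sgdIterate Ω g (fun _ => h) S i k) (S j) ∂(Measure.pi fun _ => ρ))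
      + q / (2 * γ) * (l + Y i) + γ / 2 * Δ i j := by
    intro i j
    have i0 := hs.integrable_loss_sgdAverage_fresh (n := n) (fun _ => h) i
    have i1 : Integrable (fun x : (Fin n → Z) × Z =>
        f (sgdAverage Ω g (fun _ => h) (Function.update x.1 j x.2) i) (x.1 j)) P :=
      integrable_exchange j i0
    -- The perturbed average is independent of `x.1 j`, so its loss there integrates to its
    -- population risk.
    have e1 : ∫ x : (Fin n → Z) × Z,
        f (sgdAverage Ω g (fun _ => h) (Function.update x.1 j x.2) i) (x.1 j) ∂P = Y i :=
      (integral_exchange j i0).trans (hs.integral_populationRisk_sgdAverage (fun _ => h) i)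
    have i2 : ∀ k, Integrable (fun x : (Fin n → Z) × Z =>
        f (sgdIterate Ω g (fun _ => h) x.1 i k) (x.1 j)) P := fun k =>
      integrable_fst (hs.integrable_loss_sgdIterate (fun _ => h) i k j)
    have i3 : Integrable (fun x : (Fin n → Z) × Z =>
        ‖sgdAverage Ω g (fun _ => h) (Function.update x.1 j x.2) i
          - sgdAverage Ω g (fun _ => h) x.1 i‖ ^ 2) P :=
      hs.integrable_norm_sgdAverage_exchange_sub_sq (fun _ => h) i j
    have hmono := integral_generalization_le (μ := P) (I := Finset.range T) (t := (T : ℝ)⁻¹)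
      (r := q / (2 * γ)) (l := l) (u := γ / 2) i1 i3 i2 (fun x => by
        set a := sgdAverage Ω g (fun _ => h) x.1 i with ha
        set b := sgdAverage Ω g (fun _ => h) (Function.update x.1 j x.2) i
        have h1 : f a (x.1 j) ≤ _ := loss_sgdAverage_le hs.subgradient hT hh.ne' x.1 i (x.1 j)
        -- The subgradient is taken at the perturbed average `b`: self-bounding then produces `f b
        -- (x.1 j)`, whose mean is again the risk and can later be absorbed.
        have h2 := hs.subgradient (x.1 j) b a
        have h3 : inner ℝ (g b (x.1 j)) (b - a)
            ≤ ‖g b (x.1 j)‖ ^ 2 / (2 * γ) + γ / 2 * ‖b - a‖ ^ 2 := by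
          refine (real_inner_le_norm _ _).trans ?_
          have h4 : 0 ≤ (‖g b (x.1 j)‖ - γ * ‖b - a‖) ^ 2 / (2 * γ) := by positivity
          have h5 : (‖g b (x.1 j)‖ - γ * ‖b - a‖) ^ 2 / (2 * γ)
              = ‖g b (x.1 j)‖ ^ 2 / (2 * γ) + γ / 2 * ‖b - a‖ ^ 2
                - ‖g b (x.1 j)‖ * ‖b - a‖ := by
            field_simp; ring
          linarith
        have h6 : ‖g b (x.1 j)‖ ^ 2 / (2 * γ) ≤ q / (2 * γ) * (l + f b (x.1 j)) := by
          rw [div_mul_eq_mul_div]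
          gcongr
          exact hg _ _
        have h7 : inner ℝ (g b (x.1 j)) (a - b) = -inner ℝ (g b (x.1 j)) (b - a) := by
          rw [← inner_neg_right, neg_sub]
        linarith)
    have e2 : ∀ k, ∫ x : (Fin n → Z) × Z, f (sgdIterate Ω g (fun _ => h) x.1 i k) (x.1 j) ∂P
        = ∫ S : Fin n → Z, f (sgdIterate Ω g (fun _ => h) S i k) (S j)
          ∂(Measure.pi fun _ => ρ) := fun k => integral_fst
      (φ := fun S : Fin n → Z => f (sgdIterate Ω g (fun _ => h) S i k) (S j))
    simpa only [e1, e2] using hmono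
  have hE := Finset.expect_le_expect (s := Finset.univ) fun i (_ : i ∈ Finset.univ) =>
    Finset.expect_le_expect (s := Finset.univ) fun j (_ : j ∈ Finset.univ) => key i j
  simp only [Finset.expect_add_distrib, ← Finset.mul_expect, Fintype.expect_const,
    Finset.expect_sum_comm] at hE
  rw [expectedRisk_eq_expect]
  exact hE

end HolderSetting

/-! ### Combined bounds, and a lower bound on the risk -/

namespace HolderSetting

variable {d : ℕ} {Z : Type*} [MeasurableSpace Z] {α L : ℝ} {ρ : Measure Z}
  [IsProbabilityMeasure ρ] {Ω : Set (EuclideanSpace ℝ (Fin d))}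
  {f : EuclideanSpace ℝ (Fin d) → Z → ℝ}
  {g : EuclideanSpace ℝ (Fin d) → Z → EuclideanSpace ℝ (Fin d)} {n T : ℕ} {h q l R M : ℝ}

/-- The optimization, stability and generalization bounds in terms of the mean training loss `X`
along the trajectory. -/
theorem exists_mean_bounds (hs : HolderSetting α L ρ Ω f g) (hh : 0 < h) (hl : 0 ≤ l) (hq : 0 < q)
    (hg : ∀ w z, ‖g w z‖ ^ 2 ≤ q * (l + f w z)) (hn : 0 < n) (hT : 0 < T)
    {v : EuclideanSpace ℝ (Fin d)} (hv : v ∈ Ω) (hvR : ‖v‖ ≤ R) :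
    ∃ X : ℝ, 0 ≤ X ∧
      X - populationRisk ρ f v ≤ R ^ 2 / 2 * (h * T)⁻¹ + h * q * (l + X) / 2 ∧
      ∀ τ : ℝ, 0 < τ → expectedRisk ρ Ω f g (fun _ => h) n T
        ≤ X + (l + expectedRisk ρ Ω f g (fun _ => h) n T) / (2 * τ)
          + q * τ / 2 * (Real.exp 1 * (4 * (T * (h * L) ^ (2 / (1 - α)))
            + 4 * q * ((1 + T / n) * h ^ 2 * T / n) * (l + X))) := by
  have hT' : (0 : ℝ) < T := by positivity
  set X : ℝ := (T : ℝ)⁻¹ * ∑ k ∈ Finset.range T, meanTrainingLoss ρ Ω f g h n T k with hX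
  have hsum : ∑ k ∈ Finset.range T, meanTrainingLoss ρ Ω f g h n T k = T * X := by
    rw [hX, mul_inv_cancel_left₀ hT'.ne']
  refine ⟨X, mul_nonneg (by positivity)
    (Finset.sum_nonneg fun k _ => hs.meanTrainingLoss_nonneg k), ?_, ?_⟩
  · have h1 := hs.optimization_bound (T := T) hh.le hg hn hv
    rw [Finset.sum_sub_distrib, Finset.sum_add_distrib, hsum] at h1
    simp only [Finset.sum_const, Finset.card_range, nsmul_eq_mul] at h1
    have h2 : ‖v‖ ^ 2 ≤ R ^ 2 := by gcongr
    have h3 : (X - populationRisk ρ f v) * (2 * (h * T))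
        ≤ (R ^ 2 / 2 * (h * T)⁻¹ + h * q * (l + X) / 2) * (2 * (h * T)) := by
      have e : (R ^ 2 / 2 * (h * T)⁻¹ + h * q * (l + X) / 2) * (2 * (h * T))
          = R ^ 2 + h ^ 2 * q * (T * l + T * X) := by
        field_simp
      rw [e]; linarith
    exact le_of_mul_le_mul_right h3 (by positivity)
  · intro τ hτ
    -- The weight `γ = q * τ` makes the coefficient of the absorbed risk independent of `q`.
    have h1 := hs.generalization_bound hh hg hn hT (mul_pos hq hτ)
    have h2 := hs.stability_bound (T := T) hh hl hq.le hg hn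
    simp only [Finset.sum_add_distrib, ← Finset.mul_sum, hsum, Finset.sum_const,
      Finset.card_range, nsmul_eq_mul] at h2
    rw [← hX] at h1
    have e1 : q / (2 * (q * τ)) * (l + expectedRisk ρ Ω f g (fun _ => h) n T)
        = (l + expectedRisk ρ Ω f g (fun _ => h) n T) / (2 * τ) := by
      field_simp
    rw [e1] at h1
    refine h1.trans (add_le_add_right ?_ _)
    have h3 := mul_le_mul_of_nonneg_left h2 (show 0 ≤ q * τ / 2 by positivity)
    refine h3.trans_eq ?_
    congr 2
    ring

/-- Although the initial iterate may lie outside `Ω`, the risk of the averaged iterate is nearly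
bounded below by the minimal risk on `Ω`. -/
theorem le_populationRisk_sgdAverage (hs : HolderSetting α L ρ Ω f g) (hh : h ≠ 0) (hT : 0 < T)
    {v : EuclideanSpace ℝ (Fin d)} (hv : v ∈ Ω) (hmin : IsMinOn (populationRisk ρ f) Ω v)
    (hvR : ‖v‖ ≤ R) (hvM : populationRisk ρ f v ≤ M) (S : Fin n → Z) (i : Fin T → Fin n) :
    populationRisk ρ f v - R * (1 + (1 + L) ^ 2) * (1 + M) * (T : ℝ)⁻¹
      ≤ populationRisk ρ f (sgdAverage Ω g (fun _ => h) S i) := by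
  have hR : 0 ≤ R := (norm_nonneg v).trans hvR
  have hT' : (0 : ℝ) < T := by positivity
  set a := sgdAverage Ω g (fun _ => h) S i with ha
  set p := a + (T : ℝ)⁻¹ • v with hp
  set D := R * (1 + (1 + L) ^ 2) with hD
  have hDnn : 0 ≤ D := by positivity
  have hpv : populationRisk ρ f v ≤ populationRisk ρ f p :=
    hmin (hs.average_add_mem hh hT hv S i)
  have hv0 := hs.populationRisk_nonneg v
  have ha0 := hs.populationRisk_nonneg a
  have hpt : ∀ z, f p z - D * (T : ℝ)⁻¹ * (1 + f p z) ≤ f a z := by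
    intro z
    have h1 := hs.subgradient z p a
    have h2 : inner ℝ (g p z) (a - p) = -((T : ℝ)⁻¹ * inner ℝ (g p z) v) := by
      rw [hp, ← inner_smul_right, ← inner_neg_right]; congr 1; abel
    have h3 : inner ℝ (g p z) v ≤ D * (1 + f p z) := by
      have h4 := hs.self_bounding one_pos p z
      rw [Real.one_rpow, mul_one] at h4
      have h5 := hs.loss_nonneg p z
      have h6 : ‖g p z‖ ≤ (1 + (1 + L) ^ 2) * (1 + f p z) := by
        nlinarith [sq_nonneg (‖g p z‖ - 1)]
      calc inner ℝ (g p z) v ≤ ‖g p z‖ * ‖v‖ := real_inner_le_norm _ _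
        _ ≤ ((1 + (1 + L) ^ 2) * (1 + f p z)) * R := by gcongr
        _ = D * (1 + f p z) := by rw [hD]; ring
    have h7 := mul_le_mul_of_nonneg_left h3 (show 0 ≤ (T : ℝ)⁻¹ by positivity)
    rw [h2] at h1
    linarith
  have hint : populationRisk ρ f p - D * (T : ℝ)⁻¹ * (1 + populationRisk ρ f p)
      ≤ populationRisk ρ f a := by
    have i1 := hs.integrable_loss p
    have i2 : Integrable (fun z => D * (T : ℝ)⁻¹ * (1 + f p z)) ρ :=
      ((integrable_const 1).add i1).const_mul _
    have := integral_mono (f := fun z => f p z - D * (T : ℝ)⁻¹ * (1 + f p z)) (i1.sub i2)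
      (hs.integrable_loss a) hpt
    rw [integral_sub i1 i2, integral_const_mul, integral_add (integrable_const 1) i1] at this
    simpa [populationRisk] using this
  have hDM : D * (1 + M) * (T : ℝ)⁻¹ = D * (T : ℝ)⁻¹ * (1 + M) := by ring
  rw [hDM]
  -- If `D / T ≤ 1`, the risk at `p` has the nonnegative coefficient `1 - D / T` and may be replaced
  -- by the smaller risk at `v`. Otherwise the claimed lower bound is negative.
  rcases le_total (D * (T : ℝ)⁻¹) 1 with hc | hc
  · have h0 : 0 ≤ D * (T : ℝ)⁻¹ := by positivity
    nlinarith
  · nlinarith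

theorem le_expectedRisk (hs : HolderSetting α L ρ Ω f g) (hh : h ≠ 0) (hn : 0 < n) (hT : 0 < T)
    {v : EuclideanSpace ℝ (Fin d)} (hv : v ∈ Ω) (hmin : IsMinOn (populationRisk ρ f) Ω v)
    (hvR : ‖v‖ ≤ R) (hvM : populationRisk ρ f v ≤ M) :
    populationRisk ρ f v - R * (1 + (1 + L) ^ 2) * (1 + M) * (T : ℝ)⁻¹
      ≤ expectedRisk ρ Ω f g (fun _ => h) n T := by
  have : Nonempty (Fin n) := ⟨⟨0, hn⟩⟩
  have hne : Nonempty (Fin T → Fin n) := inferInstance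
  rw [expectedRisk_eq_expect]
  refine Finset.le_expect Finset.univ_nonempty fun i _ => ?_
  have := integral_mono (μ := Measure.pi fun _ : Fin n => ρ) (integrable_const _)
    (hs.integrable_populationRisk_sgdAverage (n := n) (fun _ => h) i)
    (fun S => hs.le_populationRisk_sgdAverage hh hT hv hmin hvR hvM S i)
  rw [integral_const] at this
  simpa using this

end HolderSetting

/-! ### Excess risk bounds for a general step size -/

/-- Choice of the level in the self-bounding property. -/
theorem self_bounding_level {α K a : ℝ} (hα₀ : 0 ≤ α) (hα₁ : α < 1) (hK : 0 < K) (ha : 0 < a) :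
    K * ((K * a) ^ ((1 + α) / (1 - α))) ^ (-((1 - α) / (1 + α))) = a⁻¹ := by
  have h1 : 0 < 1 + α := by linarith
  have h2 : 0 < 1 - α := by linarith
  rw [← Real.rpow_mul (by positivity)]
  have : (1 + α) / (1 - α) * -((1 - α) / (1 + α)) = -1 := by field_simp
  rw [this, Real.rpow_neg_one]
  field_simp

/-- The slow-rate bound on the excess risk, in terms of the step size and sample size. -/
theorem exists_slow_rate (α L R M a₁ a₂ a₃ a₄ a₅ : ℝ) (hα₀ : 0 ≤ α) (hα₁ : α < 1) (hL : 0 < L)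
    (ha₂ : 0 < a₂) :
    ∃ C : ℝ, ∀ (d : ℕ) (Z : Type*) [MeasurableSpace Z] (ρ : Measure Z) [IsProbabilityMeasure ρ]
      (Ω : Set (EuclideanSpace ℝ (Fin d)))
      (f : EuclideanSpace ℝ (Fin d) → Z → ℝ)
      (g : EuclideanSpace ℝ (Fin d) → Z → EuclideanSpace ℝ (Fin d))
      (v : EuclideanSpace ℝ (Fin d)), HolderSetting α L ρ Ω f g → v ∈ Ω →
      IsMinOn (populationRisk ρ f) Ω v → ‖v‖ ≤ R → populationRisk ρ f v ≤ M →
      ∀ (n T : ℕ) (h ε : ℝ), 0 < n → 0 < T → 0 < h → 0 < ε → ε ≤ 1 →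
        (h * T)⁻¹ ≤ a₁ * ε → h ≤ a₂ * ε → T * (h * L) ^ (2 / (1 - α)) ≤ a₃ * ε ^ 2 →
        (1 + T / n) * h ^ 2 * T / n ≤ a₄ * ε ^ 2 → (T : ℝ)⁻¹ ≤ a₅ * ε →
        |expectedRisk ρ Ω f g (fun _ => h) n T - populationRisk ρ f v| ≤ C * ε := by
  -- This level gives `q = a₂⁻¹`, so that `h ≤ a₂ * ε` becomes `h * q ≤ ε`.
  set l := ((1 + L) ^ 2 * a₂) ^ ((1 + α) / (1 - α)) with hl
  have hlpos : 0 < l := by positivity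
  -- `X₀` and `Y₀` are a priori bounds, found by using `ε ≤ 1` and absorbing half of `X` and of `Y`.
  -- Reinserting them in the same inequalities extracts the factor `ε`.
  set X₀ := 2 * M + R ^ 2 * a₁ + l with hX₀
  set D₀ := Real.exp 1 * (4 * a₃ + 4 * a₂⁻¹ * a₄ * (l + X₀)) with hD₀
  set Y₀ := 2 * X₀ + l + a₂⁻¹ * D₀ with hY₀
  refine ⟨max (R * (1 + (1 + L) ^ 2) * (1 + M) * a₅)
    (R ^ 2 / 2 * a₁ + (l + X₀) / 2 + (l + Y₀) / 2 + a₂⁻¹ * D₀ / 2), ?_⟩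
  intro d Z _ ρ _ Ω f g v hs hv hmin hvR hvM n T h ε hn hT hh hε hε1 h1 h2 h3 h4 h5
  have hq := self_bounding_level hα₀ hα₁ (show 0 < (1 + L) ^ 2 by positivity) ha₂
  rw [← hl] at hq
  have hg : ∀ w z, ‖g w z‖ ^ 2 ≤ a₂⁻¹ * (l + f w z) := fun w z => by
    rw [← hq]; exact hs.self_bounding hlpos w z
  have hR : 0 ≤ R := (norm_nonneg v).trans hvR
  have hv0 := hs.populationRisk_nonneg v
  have hM : 0 ≤ M := hv0.trans hvM
  have hT' : (0 : ℝ) < T := by positivity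
  have hn' : (0 : ℝ) < n := by positivity
  -- The constants are arbitrary reals; their signs follow because they bound nonnegative
  -- quantities.
  have ha₁ : 0 ≤ a₁ := by
    by_contra hc
    have : 0 < (h * T)⁻¹ := by positivity
    nlinarith
  have ha₄ : 0 ≤ a₄ := by
    by_contra hc
    have : 0 ≤ (1 + T / n) * h ^ 2 * T / n := by positivity
    have : 0 < ε ^ 2 := by positivity
    nlinarith
  have ha₃ : 0 ≤ a₃ := by
    by_contra hc
    have : 0 ≤ T * (h * L) ^ (2 / (1 - α)) := by positivity
    have : 0 < ε ^ 2 := by positivity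
    nlinarith
  obtain ⟨X, hX, hopt, hgen⟩ :=
    hs.exists_mean_bounds hh hlpos.le (inv_pos.2 ha₂) hg hn hT hv hvR
  set F := populationRisk ρ f v
  set Y := expectedRisk ρ Ω f g (fun _ => h) n T with hY
  have hY0 : 0 ≤ Y := hs.expectedRisk_nonneg _
  have hhq : h * a₂⁻¹ ≤ ε := by
    rw [← div_eq_mul_inv, div_le_iff₀ ha₂]; linarith
  have hopt' : X - F ≤ R ^ 2 / 2 * (a₁ * ε) + ε * (l + X) / 2 := by
    refine hopt.trans ?_
    gcongr
  have hXb : X ≤ X₀ := by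
    have e1 : R ^ 2 / 2 * (a₁ * ε) ≤ R ^ 2 / 2 * (a₁ * 1) := by gcongr
    have e2 : ε * (l + X) ≤ 1 * (l + X) := by gcongr
    rw [hX₀]; linarith
  have hX₀' : 0 ≤ X₀ := hX.trans hXb
  have hXF : X - F ≤ (R ^ 2 / 2 * a₁ + (l + X₀) / 2) * ε := by
    have e2 : ε * (l + X) ≤ ε * (l + X₀) := by gcongr
    linarith
  have hD : Real.exp 1 * (4 * (T * (h * L) ^ (2 / (1 - α)))
      + 4 * a₂⁻¹ * ((1 + T / n) * h ^ 2 * T / n) * (l + X)) ≤ D₀ * ε ^ 2 := by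
    calc _ ≤ Real.exp 1 * (4 * (a₃ * ε ^ 2) + 4 * a₂⁻¹ * (a₄ * ε ^ 2) * (l + X₀)) := by gcongr
      _ = D₀ * ε ^ 2 := by rw [hD₀]; ring
  have hD₀' : 0 ≤ D₀ := by positivity
  have hgen' : Y ≤ X + (l + Y) / 2 * ε + a₂⁻¹ * D₀ / 2 * ε := by
    -- The choice `τ = ε⁻¹` balances `1 / τ` against `τ * ε ^ 2`, where `ε ^ 2` is the order of the
    -- stability term.
    refine (hgen ε⁻¹ (by positivity)).trans ?_
    have e1 : (l + Y) / (2 * ε⁻¹) = (l + Y) / 2 * ε := by field_simp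
    have e2 : a₂⁻¹ * ε⁻¹ / 2 * (D₀ * ε ^ 2) = a₂⁻¹ * D₀ / 2 * ε := by field_simp
    rw [e1, ← e2]
    gcongr
  have hYb : Y ≤ Y₀ := by
    have e1 : (l + Y) / 2 * ε ≤ (l + Y) / 2 * 1 := by gcongr
    have e2 : a₂⁻¹ * D₀ / 2 * ε ≤ a₂⁻¹ * D₀ / 2 * 1 := by gcongr
    rw [hY₀]; linarith
  rw [abs_le]
  constructor
  · have hlow := hs.le_expectedRisk hh.ne' hn hT hv hmin hvR hvM
    have e1 : R * (1 + (1 + L) ^ 2) * (1 + M) * (T : ℝ)⁻¹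
        ≤ R * (1 + (1 + L) ^ 2) * (1 + M) * (a₅ * ε) := by gcongr
    have e2 := mul_le_mul_of_nonneg_right (le_max_left (R * (1 + (1 + L) ^ 2) * (1 + M) * a₅)
      (R ^ 2 / 2 * a₁ + (l + X₀) / 2 + (l + Y₀) / 2 + a₂⁻¹ * D₀ / 2)) hε.le
    linarith
  · have e1 : (l + Y) / 2 * ε ≤ (l + Y₀) / 2 * ε := by gcongr
    have e2 := mul_le_mul_of_nonneg_right (le_max_right (R * (1 + (1 + L) ^ 2) * (1 + M) * a₅)
      (R ^ 2 / 2 * a₁ + (l + X₀) / 2 + (l + Y₀) / 2 + a₂⁻¹ * D₀ / 2)) hε.le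
    linarith

/-- The fast-rate bound on the excess risk when the minimal risk vanishes. Here `ν` is
`ε ^ (-(1 - α) / (1 + α))`. -/
theorem exists_fast_rate (α L R a₁ a₂ a₃ a₄ : ℝ) (hα₀ : 0 ≤ α) (hα₁ : α < 1) (hL : 0 < L)
    (ha₂ : 0 < a₂) :
    ∃ C : ℝ, ∀ (d : ℕ) (Z : Type*) [MeasurableSpace Z] (ρ : Measure Z) [IsProbabilityMeasure ρ]
      (Ω : Set (EuclideanSpace ℝ (Fin d)))
      (f : EuclideanSpace ℝ (Fin d) → Z → ℝ)
      (g : EuclideanSpace ℝ (Fin d) → Z → EuclideanSpace ℝ (Fin d))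
      (v : EuclideanSpace ℝ (Fin d)), HolderSetting α L ρ Ω f g → v ∈ Ω →
      ‖v‖ ≤ R → populationRisk ρ f v = 0 →
      ∀ (n T : ℕ) (h ε ν : ℝ), 0 < n → 0 < T → 0 < h → 0 < ε →
        ν = ε ^ (-((1 - α) / (1 + α))) →
        (h * T)⁻¹ ≤ a₁ * ε → h * ν ≤ a₂ → ν * (T * (h * L) ^ (2 / (1 - α))) ≤ a₃ * ε →
        ν ^ 2 * ((1 + T / n) * h ^ 2 * T / n) ≤ a₄ →
        |expectedRisk ρ Ω f g (fun _ => h) n T - populationRisk ρ f v| ≤ C * ε := by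
  set l := ((1 + L) ^ 2 * a₂) ^ ((1 + α) / (1 - α)) with hl
  have hlpos : 0 < l := by positivity
  set X₀ := R ^ 2 * a₁ + l with hX₀
  set D₀ := Real.exp 1 * (4 * a₂⁻¹ * a₃ + 4 * (a₂⁻¹) ^ 2 * a₄ * (l + X₀)) with hD₀
  refine ⟨2 * X₀ + l + D₀, ?_⟩
  intro d Z _ ρ _ Ω f g v hs hv hvR hv0 n T h ε ν hn hT hh hε hν h1 h2 h3 h4
  have hq := self_bounding_level hα₀ hα₁ (show 0 < (1 + L) ^ 2 by positivity) ha₂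
  rw [← hl] at hq
  have hνpos : 0 < ν := by rw [hν]; positivity
  -- The level is now `l * ε`, matching the expected size of the risk, at the price of the factor
  -- `ν` in `q`.
  have hg : ∀ w z, ‖g w z‖ ^ 2 ≤ a₂⁻¹ * ν * (l * ε + f w z) := fun w z => by
    rw [← hq, hν, mul_assoc ((1 + L) ^ 2), ← Real.mul_rpow hlpos.le hε.le]
    exact hs.self_bounding (by positivity) w z
  have hT' : (0 : ℝ) < T := by positivity
  have hn' : (0 : ℝ) < n := by positivity
  obtain ⟨X, hX, hopt, hgen⟩ := hs.exists_mean_bounds (q := a₂⁻¹ * ν) hh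
    (mul_pos hlpos hε).le (by positivity) hg hn hT hv hvR
  have hY0 : 0 ≤ expectedRisk ρ Ω f g (fun _ => h) n T := hs.expectedRisk_nonneg _
  -- As `X` is itself of order `ε`, a fixed weight suffices: `τ = 1` leaves half of the risk to
  -- absorb.
  have hgen1 := hgen 1 one_pos
  rw [hv0, sub_zero] at hopt ⊢
  set Y := expectedRisk ρ Ω f g (fun _ => h) n T with hY
  have hhq : h * (a₂⁻¹ * ν) ≤ 1 := by
    have : h * (a₂⁻¹ * ν) = h * ν / a₂ := by ring
    rw [this, div_le_one ha₂]; exact h2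
  have hXb : X ≤ X₀ * ε := by
    have e1 : R ^ 2 / 2 * (h * T)⁻¹ ≤ R ^ 2 / 2 * (a₁ * ε) := by gcongr
    have e2 : h * (a₂⁻¹ * ν) * (l * ε + X) ≤ 1 * (l * ε + X) := by gcongr
    rw [hX₀]; linarith
  have ha₄ : 0 ≤ a₄ := le_trans (by positivity) h4
  have hD : a₂⁻¹ * ν * 1 / 2 * (Real.exp 1 * (4 * (T * (h * L) ^ (2 / (1 - α)))
      + 4 * (a₂⁻¹ * ν) * ((1 + T / n) * h ^ 2 * T / n) * (l * ε + X))) ≤ D₀ * ε / 2 := by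
    calc _ = Real.exp 1 * (4 * a₂⁻¹ * (ν * (T * (h * L) ^ (2 / (1 - α))))
          + 4 * (a₂⁻¹) ^ 2 * (ν ^ 2 * ((1 + T / n) * h ^ 2 * T / n)) * (l * ε + X)) / 2 := by ring
      _ ≤ Real.exp 1 * (4 * a₂⁻¹ * (a₃ * ε)
          + 4 * (a₂⁻¹) ^ 2 * a₄ * (l * ε + X₀ * ε)) / 2 := by gcongr
      _ = D₀ * ε / 2 := by rw [hD₀]; ring
  rw [abs_of_nonneg hY0]
  linarith

/-! ### Polynomial schedules -/

/-- If `T` is of order `n ^ p`, every power of `T` is at most of the corresponding order. -/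
theorem rpow_le_of_comparable {κ₁ κ₂ B t : ℝ} (hκ₁ : 0 < κ₁) (hB : 0 < B) (h1 : κ₁ * B ≤ t)
    (h2 : t ≤ κ₂ * B) (s : ℝ) : t ^ s ≤ (κ₁ ^ s + |κ₂ ^ s|) * B ^ s := by
  have hκ₂ : 0 < κ₂ := by
    have : 0 < κ₁ * B := by positivity
    by_contra hc
    nlinarith
  rw [add_mul]
  rcases le_total 0 s with hs | hs
  · have h3 := Real.rpow_le_rpow (by nlinarith) h2 hs
    rw [Real.mul_rpow hκ₂.le hB.le] at h3
    rw [abs_of_pos (by positivity)]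
    have : 0 ≤ κ₁ ^ s * B ^ s := by positivity
    linarith
  · have h3 := Real.rpow_le_rpow_of_nonpos (by positivity) h1 hs
    rw [Real.mul_rpow hκ₁.le hB.le] at h3
    have : 0 ≤ |κ₂ ^ s| * B ^ s := by positivity
    linarith

/-- The absolute value makes the constant positive for every real `κ₂`, whose sign is known only
once some `t` lies in the range. -/
theorem rpow_le_of_comparable_rpow {κ₁ κ₂ p t : ℝ} {n : ℕ} (hκ₁ : 0 < κ₁) (hn : 0 < n)
    (h1 : κ₁ * (n : ℝ) ^ p ≤ t) (h2 : t ≤ κ₂ * (n : ℝ) ^ p) {s e : ℝ} (he : p * s ≤ e) :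
    t ^ s ≤ (κ₁ ^ s + |κ₂ ^ s|) * (n : ℝ) ^ e := by
  have hn' : (1 : ℝ) ≤ n := by exact_mod_cast hn
  refine (rpow_le_of_comparable hκ₁ (by positivity) h1 h2 s).trans ?_
  rw [← Real.rpow_mul (by positivity)]
  gcongr

section Rates

variable {c θ κ₁ κ₂ p : ℝ} {n T : ℕ}

theorem inv_constStep_mul_le (hc : 0 < c) (hT : 0 < T) (hκ₁ : 0 < κ₁) (hn : 0 < n)
    (h1 : κ₁ * (n : ℝ) ^ p ≤ T) (h2 : (T : ℝ) ≤ κ₂ * (n : ℝ) ^ p) {e : ℝ}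
    (he : p * (θ - 1) ≤ e) :
    (c * (T : ℝ) ^ (-θ) * T)⁻¹ ≤ c⁻¹ * (κ₁ ^ (θ - 1) + |κ₂ ^ (θ - 1)|) * (n : ℝ) ^ e := by
  have hT' : (0 : ℝ) < T := by positivity
  have e1 : (c * (T : ℝ) ^ (-θ) * T)⁻¹ = c⁻¹ * (T : ℝ) ^ (θ - 1) := by
    rw [mul_assoc, ← Real.rpow_add_one hT'.ne', mul_inv, ← Real.rpow_neg hT'.le]
    congr 2; ring
  rw [e1, mul_assoc]
  gcongr
  exact rpow_le_of_comparable_rpow hκ₁ hn h1 h2 he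

theorem constStep_le (hc : 0 < c) (hκ₁ : 0 < κ₁) (hn : 0 < n)
    (h1 : κ₁ * (n : ℝ) ^ p ≤ T) (h2 : (T : ℝ) ≤ κ₂ * (n : ℝ) ^ p) {e : ℝ}
    (he : p * (-θ) ≤ e) :
    c * (T : ℝ) ^ (-θ) ≤ c * (κ₁ ^ (-θ) + |κ₂ ^ (-θ)|) * (n : ℝ) ^ e := by
  rw [mul_assoc]
  gcongr
  exact rpow_le_of_comparable_rpow hκ₁ hn h1 h2 he

theorem mul_constStep_rpow_le {L r : ℝ} (hL : 0 < L) (hc : 0 < c) (hT : 0 < T) (hκ₁ : 0 < κ₁)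
    (hn : 0 < n) (h1 : κ₁ * (n : ℝ) ^ p ≤ T) (h2 : (T : ℝ) ≤ κ₂ * (n : ℝ) ^ p) {e : ℝ}
    (he : p * (1 - θ * r) ≤ e) :
    T * (c * (T : ℝ) ^ (-θ) * L) ^ r
      ≤ (c * L) ^ r * (κ₁ ^ (1 - θ * r) + |κ₂ ^ (1 - θ * r)|) * (n : ℝ) ^ e := by
  have hT' : (0 : ℝ) < T := by positivity
  have e1 : T * (c * (T : ℝ) ^ (-θ) * L) ^ r = (c * L) ^ r * (T : ℝ) ^ (1 - θ * r) := by
    have : c * (T : ℝ) ^ (-θ) * L = (c * L) * (T : ℝ) ^ (-θ) := by ring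
    rw [this, Real.mul_rpow (by positivity) (by positivity), ← Real.rpow_mul hT'.le,
      sub_eq_add_neg, Real.rpow_add hT', Real.rpow_one, neg_mul]
    ring
  rw [e1, mul_assoc]
  gcongr
  exact rpow_le_of_comparable_rpow hκ₁ hn h1 h2 he

/-- The two exponent conditions belong to the two parts `h² T / n` and `h² T² / n²` of the stability
term. -/
theorem stability_constStep_le (hT : 0 < T) (hκ₁ : 0 < κ₁)
    (hn : 0 < n) (h1 : κ₁ * (n : ℝ) ^ p ≤ T) (h2 : (T : ℝ) ≤ κ₂ * (n : ℝ) ^ p) {e : ℝ}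
    (he₁ : p * (1 - 2 * θ) ≤ e + 1) (he₂ : p * (2 - 2 * θ) ≤ e + 2) :
    (1 + T / n) * (c * (T : ℝ) ^ (-θ)) ^ 2 * T / n
      ≤ c ^ 2 * ((κ₁ ^ (1 - 2 * θ) + |κ₂ ^ (1 - 2 * θ)|)
        + (κ₁ ^ (2 - 2 * θ) + |κ₂ ^ (2 - 2 * θ)|)) * (n : ℝ) ^ e := by
  have hT' : (0 : ℝ) < T := by positivity
  have hn' : (0 : ℝ) < n := by positivity
  have b1 := rpow_le_of_comparable_rpow hκ₁ hn h1 h2 he₁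
  have b2 := rpow_le_of_comparable_rpow hκ₁ hn h1 h2 he₂
  rw [Real.rpow_add hn', Real.rpow_one] at b1
  rw [Real.rpow_add hn', Real.rpow_two] at b2
  have e1 : (T : ℝ) ^ (1 - 2 * θ) = ((T : ℝ) ^ (-θ)) ^ 2 * T := by
    rw [← Real.rpow_natCast, ← Real.rpow_mul hT'.le, ← Real.rpow_add_one hT'.ne']
    congr 1; push_cast; ring
  have e2 : (T : ℝ) ^ (2 - 2 * θ) = ((T : ℝ) ^ (-θ)) ^ 2 * T * T := by
    rw [← e1, ← Real.rpow_add_one hT'.ne']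
    congr 1; ring
  have e3 : (1 + T / n) * (c * (T : ℝ) ^ (-θ)) ^ 2 * T / n
      = c ^ 2 * ((T : ℝ) ^ (1 - 2 * θ) / n + (T : ℝ) ^ (2 - 2 * θ) / n ^ 2) := by
    rw [e1, e2]; field_simp
  rw [e3, mul_assoc, add_mul]
  gcongr
  · rw [div_le_iff₀ hn']; linarith
  · rw [div_le_iff₀ (by positivity)]; linarith

end Rates

/-- The slow rate under polynomial schedules `T ≍ n ^ p`, `η = c T ^ (-θ)`. -/
theorem exists_slow_rate_schedule (α L c κ₁ κ₂ R M θ p : ℝ) (hα₀ : 0 ≤ α) (hα₁ : α < 1)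
    (hL : 0 < L) (hc : 0 < c) (hκ₁ : 0 < κ₁) (e₁ : p * (θ - 1) ≤ -(1 / 2))
    (e₂ : p * (-θ) ≤ -(1 / 2)) (e₃ : p * (1 - θ * (2 / (1 - α))) ≤ -1)
    (e₄ : p * (1 - 2 * θ) ≤ 0) (e₅ : p * (2 - 2 * θ) ≤ 1) :
    ∃ C : ℝ, ∀ (d : ℕ) (Z : Type*) [MeasurableSpace Z] (ρ : Measure Z) [IsProbabilityMeasure ρ]
      (Ω : Set (EuclideanSpace ℝ (Fin d)))
      (f : EuclideanSpace ℝ (Fin d) → Z → ℝ)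
      (g : EuclideanSpace ℝ (Fin d) → Z → EuclideanSpace ℝ (Fin d))
      (v : EuclideanSpace ℝ (Fin d)), HolderSetting α L ρ Ω f g → v ∈ Ω →
      IsMinOn (populationRisk ρ f) Ω v → ‖v‖ ≤ R → populationRisk ρ f v ≤ M →
      ∀ n T : ℕ, 0 < n → κ₁ * (n : ℝ) ^ p ≤ T → (T : ℝ) ≤ κ₂ * (n : ℝ) ^ p →
        |expectedRisk ρ Ω f g (constStep c θ T) n T - populationRisk ρ f v|
          ≤ C * (n : ℝ) ^ (-(1 / 2) : ℝ) := by
  obtain ⟨C, hC⟩ := exists_slow_rate α L R M (c⁻¹ * (κ₁ ^ (θ - 1) + |κ₂ ^ (θ - 1)|))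
    (c * (κ₁ ^ (-θ) + |κ₂ ^ (-θ)|))
    ((c * L) ^ (2 / (1 - α)) * (κ₁ ^ (1 - θ * (2 / (1 - α))) + |κ₂ ^ (1 - θ * (2 / (1 - α)))|))
    (c ^ 2 * ((κ₁ ^ (1 - 2 * θ) + |κ₂ ^ (1 - 2 * θ)|)
        + (κ₁ ^ (2 - 2 * θ) + |κ₂ ^ (2 - 2 * θ)|)))
    (κ₁ ^ (-1 : ℝ) + |κ₂ ^ (-1 : ℝ)|) hα₀ hα₁ hL (by positivity)
  refine ⟨C, fun d Z _ ρ _ Ω f g v hs hv hmin hvR hvM n T hn h1 h2 => ?_⟩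
  have hn' : (1 : ℝ) ≤ n := by exact_mod_cast hn
  have hT' : (0 : ℝ) < T := lt_of_lt_of_le (by positivity) h1
  have hT : 0 < T := by exact_mod_cast hT'
  have hsq : ((n : ℝ) ^ (-(1 / 2) : ℝ)) ^ 2 = (n : ℝ) ^ (-1 : ℝ) := by
    rw [← Real.rpow_natCast, ← Real.rpow_mul (by positivity)]
    congr 1; push_cast; norm_num
  refine hC d Z ρ Ω f g v hs hv hmin hvR hvM n T (c * (T : ℝ) ^ (-θ)) _ hn hT (by positivity)
    (by positivity) (Real.rpow_le_one_of_one_le_of_nonpos hn' (by norm_num))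
    (inv_constStep_mul_le hc hT hκ₁ hn h1 h2 e₁) (constStep_le hc hκ₁ hn h1 h2 e₂) ?_ ?_ ?_
  · rw [hsq]
    exact mul_constStep_rpow_le hL hc hT hκ₁ hn h1 h2 e₃
  · rw [hsq]
    exact stability_constStep_le hT hκ₁ hn h1 h2 (by linarith) (by linarith)
  -- Adding `e₁` and `e₂` gives `-p ≤ -1`, more than the condition on `T⁻¹` requires.
  · rw [← Real.rpow_neg_one]
    exact rpow_le_of_comparable_rpow hκ₁ hn h1 h2 (by linarith)

/-- The fast rate under polynomial schedules `T ≍ n ^ p`, `η = c T ^ (-θ)`. -/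
theorem exists_fast_rate_schedule (α L c κ₁ κ₂ R θ p : ℝ) (hα₀ : 0 ≤ α) (hα₁ : α < 1)
    (hL : 0 < L) (hc : 0 < c) (hκ₁ : 0 < κ₁) (e₁ : p * (θ - 1) ≤ -((1 + α) / 2))
    (e₂ : p * (-θ) ≤ -((1 - α) / 2)) (e₃ : p * (1 - θ * (2 / (1 - α))) ≤ -1)
    (e₄ : p * (1 - 2 * θ) ≤ α) (e₅ : p * (2 - 2 * θ) ≤ 1 + α) :
    ∃ C : ℝ, ∀ (d : ℕ) (Z : Type*) [MeasurableSpace Z] (ρ : Measure Z) [IsProbabilityMeasure ρ]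
      (Ω : Set (EuclideanSpace ℝ (Fin d)))
      (f : EuclideanSpace ℝ (Fin d) → Z → ℝ)
      (g : EuclideanSpace ℝ (Fin d) → Z → EuclideanSpace ℝ (Fin d))
      (v : EuclideanSpace ℝ (Fin d)), HolderSetting α L ρ Ω f g → v ∈ Ω →
      ‖v‖ ≤ R → populationRisk ρ f v = 0 →
      ∀ n T : ℕ, 0 < n → κ₁ * (n : ℝ) ^ p ≤ T → (T : ℝ) ≤ κ₂ * (n : ℝ) ^ p →
        |expectedRisk ρ Ω f g (constStep c θ T) n T - populationRisk ρ f v|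
          ≤ C * (n : ℝ) ^ (-((1 + α) / 2)) := by
  obtain ⟨C, hC⟩ := exists_fast_rate α L R (c⁻¹ * (κ₁ ^ (θ - 1) + |κ₂ ^ (θ - 1)|))
    (c * (κ₁ ^ (-θ) + |κ₂ ^ (-θ)|))
    ((c * L) ^ (2 / (1 - α)) * (κ₁ ^ (1 - θ * (2 / (1 - α))) + |κ₂ ^ (1 - θ * (2 / (1 - α)))|))
    (c ^ 2 * ((κ₁ ^ (1 - 2 * θ) + |κ₂ ^ (1 - 2 * θ)|)
        + (κ₁ ^ (2 - 2 * θ) + |κ₂ ^ (2 - 2 * θ)|))) hα₀ hα₁ hL (by positivity)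
  refine ⟨C, fun d Z _ ρ _ Ω f g v hs hv hvR hv0 n T hn h1 h2 => ?_⟩
  have hn' : (0 : ℝ) < n := by exact_mod_cast hn
  have hT' : (0 : ℝ) < T := lt_of_lt_of_le (by positivity) h1
  have hT : 0 < T := by exact_mod_cast hT'
  have hν : (n : ℝ) ^ ((1 - α) / 2)
      = ((n : ℝ) ^ (-((1 + α) / 2))) ^ (-((1 - α) / (1 + α))) := by
    rw [← Real.rpow_mul hn'.le]
    congr 1
    have : 1 + α ≠ 0 := by linarith
    field_simp
  refine hC d Z ρ Ω f g v hs hv hvR hv0 n T (c * (T : ℝ) ^ (-θ)) _ ((n : ℝ) ^ ((1 - α) / 2))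
    hn hT (by positivity) (by positivity) hν
    (inv_constStep_mul_le hc hT hκ₁ hn h1 h2 e₁) ?_ ?_ ?_
  · have := constStep_le hc hκ₁ hn h1 h2 e₂
    calc _ ≤ c * (κ₁ ^ (-θ) + |κ₂ ^ (-θ)|) * (n : ℝ) ^ (-((1 - α) / 2))
          * (n : ℝ) ^ ((1 - α) / 2) := by gcongr
      _ = c * (κ₁ ^ (-θ) + |κ₂ ^ (-θ)|) := by
        rw [mul_assoc, ← Real.rpow_add hn', neg_add_cancel, Real.rpow_zero, mul_one]
  · have hb := mul_constStep_rpow_le hL hc hT hκ₁ hn h1 h2 e₃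
    refine (mul_le_mul_of_nonneg_left hb (by positivity)).trans_eq ?_
    rw [mul_left_comm, ← Real.rpow_add hn']
    congr 2; ring
  · have hb := stability_constStep_le (c := c) (θ := θ) (e := α - 1) hT hκ₁ hn h1 h2 (by linarith)
      (by linarith)
    refine (mul_le_mul_of_nonneg_left hb (by positivity)).trans_eq ?_
    have e : ((n : ℝ) ^ ((1 - α) / 2)) ^ 2 * (n : ℝ) ^ (α - 1) = 1 := by
      rw [← Real.rpow_natCast, ← Real.rpow_mul hn'.le, ← Real.rpow_add hn']
      have : (1 - α) / 2 * ((2 : ℕ) : ℝ) + (α - 1) = 0 := by push_cast; ring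
      rw [this, Real.rpow_zero]
    rw [mul_left_comm, e, mul_one]

/-! ### Choice of exponents in the three regimes -/

theorem mainTheorem6 (α L c κ₁ κ₂ R M : ℝ) (hα₀ : 0 ≤ α) (hα₁ : α < 1) (hL : 0 < L) (hc : 0 < c)
    (hκ₁ : 0 < κ₁) :
    ∃ C : ℝ, ∀ (d : ℕ) (Z : Type*) [MeasurableSpace Z] (ρ : Measure Z) [IsProbabilityMeasure ρ]
      (Ω : Set (EuclideanSpace ℝ (Fin d)))
      (f : EuclideanSpace ℝ (Fin d) → Z → ℝ)
      (g : EuclideanSpace ℝ (Fin d) → Z → EuclideanSpace ℝ (Fin d))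
      (wstar : EuclideanSpace ℝ (Fin d)),
      IsClosed Ω → Convex ℝ Ω →
      Measurable (Function.uncurry f) → Measurable (Function.uncurry g) →
      (∀ w, Integrable (f w) ρ) →
      (∀ w z, 0 ≤ f w z) →
      (∀ z, ConvexOn ℝ Set.univ (fun w => f w z)) →
      IsSubgradientSelection f g →
      IsHolderSubgradient α L g →
      wstar ∈ Ω → IsMinOn (populationRisk ρ f) Ω wstar →
      ‖wstar‖ ≤ R → populationRisk ρ f wstar ≤ M →
      ∀ n T : ℕ, 0 < n →
        -- the expectations below are genuine (finite) expectations
        (∀ θ ∈ Set.Icc (0 : ℝ) 1, ∀ i : Fin T → Fin n,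
          Integrable (fun S : Fin n → Z =>
            populationRisk ρ f (sgdAverage Ω g (constStep c θ T) S i)) (Measure.pi fun _ => ρ)) ∧
        -- (a)
        (1 / 2 ≤ α → κ₁ * (n : ℝ) ≤ T → (T : ℝ) ≤ κ₂ * (n : ℝ) →
          |expectedRisk ρ Ω f g (constStep c (1 / 2) T) n T - populationRisk ρ f wstar|
            ≤ C * (n : ℝ) ^ (-(1 / 2) : ℝ)) ∧
        -- (b)
        (α < 1 / 2 → κ₁ * (n : ℝ) ^ ((2 - α) / (1 + α)) ≤ T →
          (T : ℝ) ≤ κ₂ * (n : ℝ) ^ ((2 - α) / (1 + α)) →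
          |expectedRisk ρ Ω f g (constStep c ((3 - 3 * α) / (2 * (2 - α))) T) n T
              - populationRisk ρ f wstar|
            ≤ C * (n : ℝ) ^ (-(1 / 2) : ℝ)) ∧
        -- (c)
        (populationRisk ρ f wstar = 0 → κ₁ * (n : ℝ) ^ (2 / (1 + α)) ≤ T →
          (T : ℝ) ≤ κ₂ * (n : ℝ) ^ (2 / (1 + α)) →
          |expectedRisk ρ Ω f g (constStep c ((3 - α ^ 2 - 2 * α) / 4) T) n T
              - populationRisk ρ f wstar|
            ≤ C * (n : ℝ) ^ (-((1 + α) / 2))) := by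

  have hα : 0 < 1 + α := by linarith
  have hα' : 0 < 1 - α := by linarith
  obtain ⟨Ca, hCa⟩ : ∃ C : ℝ, 1 / 2 ≤ α → ∀ (d : ℕ) (Z : Type _) [MeasurableSpace Z]
      (ρ : Measure Z) [IsProbabilityMeasure ρ] (Ω : Set (EuclideanSpace ℝ (Fin d)))
      (f : EuclideanSpace ℝ (Fin d) → Z → ℝ)
      (g : EuclideanSpace ℝ (Fin d) → Z → EuclideanSpace ℝ (Fin d))
      (v : EuclideanSpace ℝ (Fin d)), HolderSetting α L ρ Ω f g → v ∈ Ω →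
      IsMinOn (populationRisk ρ f) Ω v → ‖v‖ ≤ R → populationRisk ρ f v ≤ M →
      ∀ n T : ℕ, 0 < n → κ₁ * (n : ℝ) ^ (1 : ℝ) ≤ T → (T : ℝ) ≤ κ₂ * (n : ℝ) ^ (1 : ℝ) →
        |expectedRisk ρ Ω f g (constStep c (1 / 2) T) n T - populationRisk ρ f v|
          ≤ C * (n : ℝ) ^ (-(1 / 2) : ℝ) := by
    -- One constant has to serve all three parts, so outside its range of `α` this part takes the
    -- dummy constant `0`.
    by_cases h : 1 / 2 ≤ α
    -- With `θ = 1 / 2` and `p = 1` the accumulated Hölder error is small enough exactly when `α ≥ 1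
    -- / 2`.
    · have e₃ : (1 : ℝ) * (1 - 1 / 2 * (2 / (1 - α))) ≤ -1 := by
        have : 2 ≤ 1 / (1 - α) := by rw [le_div_iff₀ hα']; linarith
        have e : (1 : ℝ) / 2 * (2 / (1 - α)) = 1 / (1 - α) := by ring
        rw [e]; linarith
      obtain ⟨C, hC⟩ := exists_slow_rate_schedule α L c κ₁ κ₂ R M (1 / 2) 1 hα₀ hα₁ hL hc hκ₁
        (by norm_num) (by norm_num) e₃ (by norm_num) (by norm_num)
      exact ⟨C, fun _ => hC⟩
    · exact ⟨0, fun h' => absurd h' h⟩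
  obtain ⟨Cb, hCb⟩ : ∃ C : ℝ, α < 1 / 2 → ∀ (d : ℕ) (Z : Type _) [MeasurableSpace Z]
      (ρ : Measure Z) [IsProbabilityMeasure ρ] (Ω : Set (EuclideanSpace ℝ (Fin d)))
      (f : EuclideanSpace ℝ (Fin d) → Z → ℝ)
      (g : EuclideanSpace ℝ (Fin d) → Z → EuclideanSpace ℝ (Fin d))
      (v : EuclideanSpace ℝ (Fin d)), HolderSetting α L ρ Ω f g → v ∈ Ω →
      IsMinOn (populationRisk ρ f) Ω v → ‖v‖ ≤ R → populationRisk ρ f v ≤ M →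
      ∀ n T : ℕ, 0 < n → κ₁ * (n : ℝ) ^ ((2 - α) / (1 + α)) ≤ T →
        (T : ℝ) ≤ κ₂ * (n : ℝ) ^ ((2 - α) / (1 + α)) →
        |expectedRisk ρ Ω f g (constStep c ((3 - 3 * α) / (2 * (2 - α))) T) n T
            - populationRisk ρ f v| ≤ C * (n : ℝ) ^ (-(1 / 2) : ℝ) := by
    by_cases h : α < 1 / 2
    · have h2 : 0 < 2 - α := by linarith
      -- Equality in the optimization condition `e₁` and the Hölder error condition `e₃` determines
      -- `θ` and `p`.
      have e₁ : (2 - α) / (1 + α) * ((3 - 3 * α) / (2 * (2 - α)) - 1) = -(1 / 2) := by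
        field_simp; ring
      have e₂ : (2 - α) / (1 + α) * ((3 - 3 * α) / (2 * (2 - α)))
          = 1 / 2 + (1 - 2 * α) / (1 + α) := by
        field_simp; ring
      have e₃ : (2 - α) / (1 + α) * (1 - (3 - 3 * α) / (2 * (2 - α)) * (2 / (1 - α))) = -1 := by
        field_simp; ring
      have e₄ : (2 - α) / (1 + α) = 1 + (1 - 2 * α) / (1 + α) := by
        field_simp; ring
      have e₅ : 0 ≤ (1 - 2 * α) / (1 + α) := div_nonneg (by linarith) hα.le
      obtain ⟨C, hC⟩ := exists_slow_rate_schedule α L c κ₁ κ₂ R M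
        ((3 - 3 * α) / (2 * (2 - α))) ((2 - α) / (1 + α)) hα₀ hα₁ hL hc hκ₁ e₁.le
        (by linarith) e₃.le (by linarith) (by linarith)
      exact ⟨C, fun _ => hC⟩
    · exact ⟨0, fun h' => absurd h' h⟩
  -- Again equality in the first and third conditions fixes the exponents; the second and fourth
  -- have slack `(1 - α) / (1 + α)`.
  obtain ⟨Cc, hCc⟩ := exists_fast_rate_schedule α L c κ₁ κ₂ R
    ((3 - α ^ 2 - 2 * α) / 4) (2 / (1 + α)) hα₀ hα₁ hL hc hκ₁
    (le_of_eq (by field_simp; ring))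
    (by
      have e : 2 / (1 + α) * -((3 - α ^ 2 - 2 * α) / 4)
          = -((1 - α) / 2) - (1 - α) / (1 + α) := by field_simp; ring
      have : 0 ≤ (1 - α) / (1 + α) := div_nonneg hα'.le hα.le
      linarith)
    (le_of_eq (by field_simp; ring))
    (by
      have e : 2 / (1 + α) * (1 - 2 * ((3 - α ^ 2 - 2 * α) / 4))
          = α - (1 - α) / (1 + α) := by field_simp; ring
      have : 0 ≤ (1 - α) / (1 + α) := div_nonneg hα'.le hα.le
      linarith)
    (le_of_eq (by field_simp; ring))
  refine ⟨max (max Ca Cb) Cc, ?_⟩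
  intro d Z _ ρ _ Ω f g wstar hΩc hΩ hfm hgm hfi hf0 _ hsub hhol hw hmin hR hM n T hn
  have hs : HolderSetting α L ρ Ω f g :=
    ⟨hα₀, hα₁, hL.le, hΩc, hΩ, ⟨wstar, hw⟩, hfm, hgm, hfi, hf0, hsub, hhol⟩
  refine ⟨fun θ _ i => hs.integrable_populationRisk_sgdAverage _ i, ?_, ?_, ?_⟩
  · intro h h1 h2
    refine (hCa h d Z ρ Ω f g wstar hs hw hmin hR hM n T hn (by rwa [Real.rpow_one])
      (by rwa [Real.rpow_one])).trans ?_
    gcongr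
    exact (le_max_left _ _).trans (le_max_left _ _)
  · intro h h1 h2
    refine (hCb h d Z ρ Ω f g wstar hs hw hmin hR hM n T hn h1 h2).trans ?_
    gcongr
    exact (le_max_right _ _).trans (le_max_left _ _)
  · intro h h1 h2
    refine (hCc d Z ρ Ω f g wstar hs hw hR h n T hn h1 h2).trans ?_
    gcongr
    exact le_max_right _ _
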